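/- **Theorem.** Fix $k\in\mathbb N$. For a matrix $\mathbf M\in\mathbb Q^{n\times m}$ let $r^{\mathsf{dsc}}_{\mathrm{Max}}(\mathbf M)$ be the permutation $\pi$ of $\{1,\dots,n\}$ that ranks the rows by decreasing maximum entry, ties being broken by the row index: $\pi(i)<\pi(i')$ if and only if $\max_j \mathbf M_{ij}>\max_j \mathbf M_{i'j}$, or the two maxima are equal and $i<i'$. (If $m=0$, all rows are tied.) For $\mathbf u\in\mathbb Q^m$ let $\mathbf M\circ\mathbf u$ be the matrix obtained from $\mathbf M$ by multiplying the $j$th column by $u_j$, for $j=1,\dots,m$. Consider the following problem. *Input:* a matrix $\mathbf M\in\mathbb Q^{n\times m}$; finite probability distributions $\Pi_1,\dots,\Pi_m$ on $\mathbb Q$, each given as a list of value–probability pairs; a row index $i\in\{1,\dots,n\}$. Every rational number is given as a pair $(a,b)$ of integers in binary, with $b\neq0$, which stands for $a/b$. *Output:* a pair of integers $(a,b)$, $b\ne 0$, such that $a/b$ is the expected change of the top-$k$ membership of row $i$, $$\mathbb E_{\mathbf u\sim\Pi_1\otimes\dots\otimes\Pi_m}\Big[\mathbb 1_{\pi_{\mathbf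 u}(i)\le k}-\mathbb 1_{\pi_0(i)\le k}\Big],\qquad \pi_{\mathbf u}=r^{\mathsf{dsc}}_{\mathrm{Max}}(\mathbf M\circ\mathbf u),\quad \pi_0=r^{\mathsf{dsc}}_{\mathrm{Max}}(\mathbf M).$$ For every fixed $k$ this problem is solvable in polynomial time: there are a program for a random access machine and a polynomial, both depending only on $k$, such that on every input the program halts with a correct output, and its cost under the logarithmic (bit) cost criterion is at most the polynomial evaluated at the total binary length of the input. -/

import Mathlib

/-! ### Random access machines with the logarithmic cost criterion -/

namespace RAM

/-- A machine has registers and a main memory; every cell holds an integer. -/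
structure State where
  reg : ℕ → ℤ
  mem : ℕ → ℤ

/-- The length of an integer in binary: its bits and one symbol for the sign. -/
def bitLength (z : ℤ) : ℕ := Nat.size z.natAbs + 1

/-- Programs. The arguments `d a b` are register numbers, fixed in the program text. -/
inductive Prog : Type
  | skip : Prog
  /-- `reg d := z` -/
  | const (d : ℕ) (z : ℤ) : Prog
  /-- `reg d := reg a + reg b` -/
  | add (d a b : ℕ) : Prog
  /-- `reg d := reg a - reg b` -/
  | sub (d a b : ℕ) : Prog
  /-- `reg d := reg a * reg b` -/
  | mul (d a b : ℕ) : Prog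
  /-- `reg d := mem (reg a)` (indirect addressing; a negative address means cell `0`) -/
  | load (d a : ℕ) : Prog
  /-- `mem (reg a) := reg b` -/
  | store (a b : ℕ) : Prog
  | seq (p q : Prog) : Prog
  /-- if `reg a > 0` then `p` else `q` -/
  | ite (a : ℕ) (p q : Prog) : Prog
  /-- while `reg a > 0` do `p` -/
  | loop (a : ℕ) (p : Prog) : Prog

def State.setReg (s : State) (d : ℕ) (z : ℤ) : State :=
  { s with reg := Function.update s.reg d z }

def State.setMem (s : State) (x : ℕ) (z : ℤ) : State :=
  { s with mem := Function.update s.mem x z }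

/-- `Exec p s t s'`: the program `p`, started in the state `s`, halts in the state `s'`, and the
total cost of the run is `t`. Every executed instruction, and every test, is charged the total
length in binary of the integers (operands and addresses) on which it acts. -/
inductive Exec : Prog → State → ℕ → State → Prop
  | skip (s : State) : Exec .skip s 1 s
  | const (s : State) (d : ℕ) (z : ℤ) : Exec (.const d z) s (bitLength z) (s.setReg d z)
  | add (s : State) (d a b : ℕ) :
      Exec (.add d a b) s (bitLength (s.reg a) + bitLength (s.reg b))
        (s.setReg d (s.reg a + s.reg b))
  | sub (s : State) (d a b : ℕ) :
      Exec (.sub d a b) s (bitLength (s.reg a) + bitLength (s.reg b))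
        (s.setReg d (s.reg a - s.reg b))
  | mul (s : State) (d a b : ℕ) :
      Exec (.mul d a b) s (bitLength (s.reg a) + bitLength (s.reg b))
        (s.setReg d (s.reg a * s.reg b))
  | load (s : State) (d a : ℕ) :
      Exec (.load d a) s (bitLength (s.reg a) + bitLength (s.mem (s.reg a).toNat))
        (s.setReg d (s.mem (s.reg a).toNat))
  | store (s : State) (a b : ℕ) :
      Exec (.store a b) s (bitLength (s.reg a) + bitLength (s.reg b))
        (s.setMem (s.reg a).toNat (s.reg b))
  | seq {p q : Prog} {s s' s'' : State} {t t' : ℕ} :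
      Exec p s t s' → Exec q s' t' s'' → Exec (.seq p q) s (t + t') s''
  | ite_pos {a : ℕ} {p q : Prog} {s s' : State} {t : ℕ} :
      0 < s.reg a → Exec p s t s' → Exec (.ite a p q) s (bitLength (s.reg a) + t) s'
  | ite_neg {a : ℕ} {p q : Prog} {s s' : State} {t : ℕ} :
      s.reg a ≤ 0 → Exec q s t s' → Exec (.ite a p q) s (bitLength (s.reg a) + t) s'
  | loop_stop {a : ℕ} {p : Prog} {s : State} :
      s.reg a ≤ 0 → Exec (.loop a p) s (bitLength (s.reg a)) s
  | loop_step {a : ℕ} {p : Prog} {s s' s'' : State} {t t' : ℕ} :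
      0 < s.reg a → Exec p s t s' → Exec (.loop a p) s' t' s'' →
        Exec (.loop a p) s (bitLength (s.reg a) + t + t') s''

/-- The initial state for a list of integers: the list is in the memory from cell `0` on, its
length is in register `0`, and everything else is `0`. -/
def input (l : List ℤ) : State where
  reg := fun a => if a = 0 then (l.length : ℤ) else 0
  mem := fun x => l.getD x 0

/-- The list of integers that is read off a final state: register `0` holds its length, and the
list is in the memory from cell `0` on. -/
def output (s : State) : List ℤ := (List.range (s.reg 0).toNat).map s.mem

/-- The size of an input: the total length in binary of its integers. -/
def inputSize (l : List ℤ) : ℕ := (l.map bitLength).sum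

/-- The computational problem with instances `x : α`, written as `encode x`, where `IsAnswer x l`
says that the list `l` is a correct answer for `x`, is solved by a program whose cost is bounded
by a polynomial in the size of the instance. -/
def SolvableInPolyTime {α : Type*} (encode : α → List ℤ) (IsAnswer : α → List ℤ → Prop) : Prop :=
  ∃ (p : Prog) (P : Polynomial ℕ), ∀ x : α, ∃ (t : ℕ) (s : State),
    Exec p (input (encode x)) t s ∧ t ≤ P.eval (inputSize (encode x)) ∧ IsAnswer x (output s)

end RAM

/-! ### Ranking the rows of a matrix -/

namespace Ranking

/-- A ranking function maps a matrix with `n` rows to a permutation `π` of the rows; `π i` is the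
position of row `i`. Rows and positions are numbered from `0`. -/
abbrev RankingFunction : Type :=
  ∀ ⦃n m : ℕ⦄, Matrix (Fin n) (Fin m) ℚ → Equiv.Perm (Fin n)

/-- The largest entry of a row (`⊥` if there are no columns). -/
def maxScore {m : ℕ} (row : Fin m → ℚ) : WithBot ℚ :=
  Finset.univ.sup fun j => (row j : WithBot ℚ)

/-- Ranking by descending maximum, ties being broken by the row number: `Tuple.sort` is the
stable sorting permutation, which maps positions to rows. -/
def maxDsc : RankingFunction := fun _ _ M =>
  (Tuple.sort fun i => OrderDual.toDual (maxScore (M i))).symm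

/-- A local effect function: the effect on the row `i` of replacing the original order `π₀` of
the rows by `π`. -/
abbrev LocalEffect : Type :=
  ∀ ⦃n : ℕ⦄, Fin n → Equiv.Perm (Fin n) → Equiv.Perm (Fin n) → ℤ

/-- Top-`k` membership: `1[π(i) ≤ k] - 1[π₀(i) ≤ k]` for positions numbered from `1`. -/
def topMembership (k : ℕ) : LocalEffect := fun _ i π₀ π =>
  (if (π i : ℕ) + 1 ≤ k then 1 else 0) - (if (π₀ i : ℕ) + 1 ≤ k then 1 else 0)

/-- Multiply the `j`th column of the matrix by `u j`, for all `j`. -/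
def weighted {n m : ℕ} (M : Matrix (Fin n) (Fin m) ℚ) (u : Fin m → ℚ) :
    Matrix (Fin n) (Fin m) ℚ :=
  Matrix.of fun i j => M i j * u j

/-! ### The problem of computing the expected effect -/

/-- A rational number, represented by a pair of integers (not necessarily in lowest terms). -/
structure Frac where
  num : ℤ
  den : ℤ
  den_ne_zero : den ≠ 0

def Frac.toRat (q : Frac) : ℚ := (q.num : ℚ) / (q.den : ℚ)

def Frac.encode (q : Frac) : List ℤ := [q.num, q.den]

/-- A finite probability distribution on `ℚ`, given as a list of pairs (value, probability). -/
structure FinDist where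
  pairs : List (Frac × Frac)
  prob_nonneg : ∀ vp ∈ pairs, 0 ≤ vp.2.toRat
  prob_sum : (pairs.map fun vp => vp.2.toRat).sum = 1

def FinDist.value (D : FinDist) (c : Fin D.pairs.length) : ℚ := (D.pairs.get c).1.toRat

def FinDist.prob (D : FinDist) (c : Fin D.pairs.length) : ℚ := (D.pairs.get c).2.toRat

/-- The number of pairs, followed by the pairs. -/
def FinDist.encode (D : FinDist) : List ℤ :=
  (D.pairs.length : ℤ) :: D.pairs.flatMap fun vp => vp.1.encode ++ vp.2.encode

/-- An instance: a matrix, a distribution of the weight of each column, and a row. -/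
structure Instance where
  n : ℕ
  m : ℕ
  entry : Matrix (Fin n) (Fin m) Frac
  dist : Fin m → FinDist
  row : Fin n

/-- The matrix of rational numbers that an instance represents. -/
def Instance.matrix (I : Instance) : Matrix (Fin I.n) (Fin I.m) ℚ :=
  I.entry.map Frac.toRat

/-- The dimensions and the row number, the entries of the matrix row by row, the distributions. -/
def Instance.encode (I : Instance) : List ℤ :=
  [(I.n : ℤ), (I.m : ℤ), ((I.row : ℕ) : ℤ)]
    ++ (List.finRange I.n).flatMap
        (fun i => (List.finRange I.m).flatMap fun j => (I.entry i j).encode)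
    ++ (List.finRange I.m).flatMap fun j => (I.dist j).encode

/-- The expected effect on the row of the instance when the column weights are drawn
independently from the given distributions. The sum runs over the choices `c` of one pair from
each of the lists; the choice `c` has the probability `∏ j, prob (c j)` and yields the weight
vector `u` with `u j = value (c j)`. -/
def expectedEffect (r : RankingFunction) (e : LocalEffect) (I : Instance) : ℚ :=
  ∑ c : (j : Fin I.m) → Fin (I.dist j).pairs.length,
    (∏ j, (I.dist j).prob (c j)) *
      (e I.row (r I.matrix) (r (weighted I.matrix fun j => (I.dist j).value (c j))) : ℚ)

/-- The problem of computing the expected effect, as a pair of integers that represents it, is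
solvable in polynomial time, for the (fixed) ranking function `r` and effect function `e`. -/
def ExpSolvableInPolyTime (r : RankingFunction) (e : LocalEffect) : Prop :=
  RAM.SolvableInPolyTime Instance.encode fun I out =>
    ∃ q : Frac, out = q.encode ∧ q.toRat = expectedEffect r e I

end Ranking

/-! Write `k = K + 1`; row `i` is in the top `k` exactly when at most `K` rows are ranked before it.
The sum over all choices of weights is exponential, so it is regrouped into terms that factor over
the columns.

For a drawn matrix `X` there is exactly one column `j` in which row `i` has its leftmost maximum
(`existsUnique_notMem_violating`). Fix `j` and the drawn weight of that column. The threshold `X i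
j` is then a constant, and the rows ranked before `i` are those having an entry that fails to
conform to it (`violating_eq_before`). For a fixed set `S` of rows, the event that only rows of `S`
are violating, and not `i` itself, is a conjunction of one condition per column
(`forall_admissible_iff`). By independence its probability is a product of short sums
(`prod_sum_ite`).

It remains to express "at most `K` violating rows" through such events. With `V` the set of
violating rows, `|V \ S| ≤ 0` means `V ⊆ S`, and `card_le_succ_recursion` reduces the bound `l + 1`
to the bound `l` at the cost of one sum over a row added to `S`. After `K` steps there are at most
`K` nested sums over rows, which is polynomial for fixed `K`. The factorials and the product of all
probability denominators keep everything integral.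

On the machine side, numerator and denominator are expressions (`Term`) built from arithmetic,
memory access, sums and products of polynomial range, and a clamped iteration. Every fixed
expression has values of polynomial size (`exists_bitLength_eval_le`) and compiles to a program of
polynomial cost (`compile_runs`), so it suffices to exhibit two expressions with the right quotient
(`effect_spec`). -/

namespace RAM

/-! ### Sizes of integers -/

theorem bitLength_le_iff {z : ℤ} {B : ℕ} : bitLength z ≤ B + 1 ↔ z.natAbs < 2 ^ B := by
  rw [bitLength, Nat.add_le_add_iff_right, Nat.size_le]

theorem bitLength_pos (z : ℤ) : 1 ≤ bitLength z := Nat.le_add_left _ _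

/-- This is weaker than "maximum plus one", but it is the same law as for products, so accumulating
sums and accumulating products can share one cost analysis. -/
theorem bitLength_add_le (a b : ℤ) : bitLength (a + b) ≤ bitLength a + bitLength b := by
  have ha : a.natAbs < 2 ^ Nat.size a.natAbs := Nat.lt_size_self _
  have hb : b.natAbs < 2 ^ Nat.size b.natAbs := Nat.lt_size_self _
  have h : (a + b).natAbs < 2 ^ (Nat.size a.natAbs + Nat.size b.natAbs + 1) := by
    have h1 := Int.natAbs_add_le a b
    have h2 : 2 ^ Nat.size a.natAbs ≤ 2 ^ (Nat.size a.natAbs + Nat.size b.natAbs) :=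
      Nat.pow_le_pow_right (by norm_num) (by omega)
    have h3 : 2 ^ Nat.size b.natAbs ≤ 2 ^ (Nat.size a.natAbs + Nat.size b.natAbs) :=
      Nat.pow_le_pow_right (by norm_num) (by omega)
    rw [pow_succ]
    omega
  have := bitLength_le_iff.2 h
  unfold bitLength at *
  omega

theorem bitLength_neg (a : ℤ) : bitLength (-a) = bitLength a := by simp [bitLength]

theorem bitLength_sub_le (a b : ℤ) : bitLength (a - b) ≤ bitLength a + bitLength b := by
  rw [sub_eq_add_neg, ← bitLength_neg b]
  exact bitLength_add_le _ _

theorem bitLength_mul_le (a b : ℤ) : bitLength (a * b) ≤ bitLength a + bitLength b := by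
  have ha : a.natAbs < 2 ^ Nat.size a.natAbs := Nat.lt_size_self _
  have hb : b.natAbs < 2 ^ Nat.size b.natAbs := Nat.lt_size_self _
  have h : (a * b).natAbs < 2 ^ (Nat.size a.natAbs + Nat.size b.natAbs) := by
    rw [Int.natAbs_mul, pow_add]
    exact Nat.mul_lt_mul'' ha hb
  have := bitLength_le_iff.2 h
  unfold bitLength at *
  omega

theorem bitLength_le_of_le {z : ℤ} {n : ℕ} (h0 : 0 ≤ z) (h : z ≤ n) : bitLength z ≤ n + 1 := by
  refine bitLength_le_iff.2 (lt_of_le_of_lt ?_ (Nat.lt_two_pow_self (n := n)))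
  omega

@[simp] theorem bitLength_zero : bitLength 0 = 1 := by simp [bitLength]

@[simp] theorem bitLength_one : bitLength 1 = 2 := by simp [bitLength]

/-! ### Runs with a bound on the cost and a postcondition -/

/-- The program halts at a cost of at most `T` in a state that satisfies `Q`. -/
def Runs (p : Prog) (s : State) (T : ℕ) (Q : State → Prop) : Prop :=
  ∃ (t : ℕ) (s' : State), Exec p s t s' ∧ t ≤ T ∧ Q s'

namespace Runs

variable {p q : Prog} {s : State} {T T' : ℕ} {Q R : State → Prop}

theorem mono (h : Runs p s T Q) (hT : T ≤ T') (hQ : ∀ s', Q s' → R s') : Runs p s T' R := by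
  obtain ⟨t, s', he, ht, hq⟩ := h
  exact ⟨t, s', he, ht.trans hT, hQ _ hq⟩

theorem seq (h : Runs p s T R) (h' : ∀ s', R s' → Runs q s' T' Q) :
    Runs (.seq p q) s (T + T') Q := by
  obtain ⟨t, s', he, ht, hq⟩ := h
  obtain ⟨t', s'', he', ht', hq'⟩ := h' s' hq
  exact ⟨_, _, .seq he he', by omega, hq'⟩

theorem const {d : ℕ} {z : ℤ} (hT : bitLength z ≤ T) (h : Q (s.setReg d z)) :
    Runs (.const d z) s T Q := ⟨_, _, .const .., hT, h⟩

theorem add {d a b : ℕ} (hT : bitLength (s.reg a) + bitLength (s.reg b) ≤ T)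
    (h : Q (s.setReg d (s.reg a + s.reg b))) : Runs (.add d a b) s T Q :=
  ⟨_, _, .add .., hT, h⟩

theorem sub {d a b : ℕ} (hT : bitLength (s.reg a) + bitLength (s.reg b) ≤ T)
    (h : Q (s.setReg d (s.reg a - s.reg b))) : Runs (.sub d a b) s T Q :=
  ⟨_, _, .sub .., hT, h⟩

theorem mul {d a b : ℕ} (hT : bitLength (s.reg a) + bitLength (s.reg b) ≤ T)
    (h : Q (s.setReg d (s.reg a * s.reg b))) : Runs (.mul d a b) s T Q :=
  ⟨_, _, .mul .., hT, h⟩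

theorem load {d a : ℕ} (hT : bitLength (s.reg a) + bitLength (s.mem (s.reg a).toNat) ≤ T)
    (h : Q (s.setReg d (s.mem (s.reg a).toNat))) : Runs (.load d a) s T Q :=
  ⟨_, _, .load .., hT, h⟩

theorem store {a b : ℕ} (hT : bitLength (s.reg a) + bitLength (s.reg b) ≤ T)
    (h : Q (s.setMem (s.reg a).toNat (s.reg b))) : Runs (.store a b) s T Q :=
  ⟨_, _, .store .., hT, h⟩

theorem ite {a : ℕ} (hp : 0 < s.reg a → Runs p s T Q) (hq : s.reg a ≤ 0 → Runs q s T Q) :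
    Runs (.ite a p q) s (bitLength (s.reg a) + T) Q := by
  rcases lt_or_ge 0 (s.reg a) with h | h
  · obtain ⟨t, s', he, ht, hq⟩ := hp h
    exact ⟨_, s', .ite_pos h he, by omega, hq⟩
  · obtain ⟨t, s', he, ht, hq⟩ := hq h
    exact ⟨_, s', .ite_neg h he, by omega, hq⟩

/-- A loop whose test register `c` counts down from `N`. -/
theorem loop {c : ℕ} (N : ℕ) (I : ℕ → State → Prop) {B : ℕ}
    (hc : ∀ i s, I i s → s.reg c = i) (hB : ∀ i ≤ N, bitLength (i : ℤ) ≤ B)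
    (hstep : ∀ i < N, ∀ s, I (i + 1) s → Runs p s T (I i)) (hs : I N s) :
    Runs (.loop c p) s (N * (B + T) + B) (I 0) := by
  induction N generalizing s with
  | zero =>
    have h0 := hc _ _ hs
    exact ⟨_, s, Exec.loop_stop (by simp [h0]), by simpa [h0] using hB 0 le_rfl, hs⟩
  | succ N ih =>
    obtain ⟨t, s', he, ht, hI⟩ := hstep N (by omega) s hs
    obtain ⟨t', s'', he', ht', hI'⟩ :=
      ih (fun i hi => hB i (by omega)) (fun i hi => hstep i (by omega)) hI
    have h0 := hc _ _ hs
    refine ⟨_, s'', .loop_step (by rw [h0]; positivity) he he', ?_, hI'⟩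
    have := hB (N + 1) le_rfl
    rw [h0]
    nlinarith

end Runs

/-! ### Integer expressions with bounded sums, products and iterations -/

/-- Expressions over named integer variables and a read-only memory. The bound variable of `sum`
and `prod` runs over `0, …, L - 1`, where `L` is the length of the input. -/
inductive Term : Type
  | const (z : ℤ) : Term
  | var (v : ℕ) : Term
  | mem (e : Term) : Term
  | add (a b : Term) : Term
  | sub (a b : Term) : Term
  | mul (a b : Term) : Term
  /-- if `c > 0` then `a` else `b` -/
  | ite (c a b : Term) : Term
  | sum (v : ℕ) (e : Term) : Term
  | prod (v : ℕ) (e : Term) : Term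
  /-- start with `x = 0`, and for `v = L - 1, …, 0` replace `x` by the value of `e`, cut off to
  `0` unless it is between `0` and `L` -/
  | iter (v x : ℕ) (e : Term) : Term

/-- Apply `f (n - 1)`, …, `f 0` in this order. -/
def descend (f : ℕ → ℤ → ℤ) : ℕ → ℤ → ℤ
  | 0, a => a
  | n + 1, a => descend f n (f n a)

theorem descend_add (f : ℕ → ℤ) (n : ℕ) (a : ℤ) :
    descend (fun i acc => acc + f i) n a = a + ∑ i ∈ Finset.range n, f i := by
  induction n generalizing a with
  | zero => simp [descend]
  | succ n ih => rw [descend, ih, Finset.sum_range_succ]; ring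

theorem descend_mul (f : ℕ → ℤ) (n : ℕ) (a : ℤ) :
    descend (fun i acc => acc * f i) n a = a * ∏ i ∈ Finset.range n, f i := by
  induction n generalizing a with
  | zero => simp [descend]
  | succ n ih => rw [descend, ih, Finset.prod_range_succ]; ring

theorem descend_induction {f : ℕ → ℤ → ℤ} (A : ℕ → ℤ → Prop) {n : ℕ} {a : ℤ} (h : A n a)
    (hstep : ∀ i < n, ∀ a, A (i + 1) a → A i (f i a)) : A 0 (descend f n a) := by
  induction n generalizing a with
  | zero => exact h
  | succ n ih => exact ih (hstep n (by omega) _ h) fun i hi => hstep i (by omega)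

/-- Cut off to `0` outside of the range from `0` to `L`. -/
def clamp (L : ℕ) (z : ℤ) : ℤ := if 0 < z then if 0 < 1 + (L : ℤ) - z then z else 0 else 0

theorem clamp_nonneg (L : ℕ) (z : ℤ) : 0 ≤ clamp L z := by
  unfold clamp; split_ifs <;> omega

theorem clamp_le (L : ℕ) (z : ℤ) : clamp L z ≤ L := by
  unfold clamp; split_ifs <;> omega

theorem clamp_of_le {L : ℕ} {z : ℤ} (h0 : 0 ≤ z) (h : z ≤ L) : clamp L z = z := by
  unfold clamp; split_ifs <;> omega

namespace Term

/-- The value of an expression. -/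
def eval (L : ℕ) (mem : ℕ → ℤ) : Term → (ℕ → ℤ) → ℤ
  | const z, _ => z
  | var v, env => env v
  | .mem e, env => mem (eval L mem e env).toNat
  | add a b, env => eval L mem a env + eval L mem b env
  | sub a b, env => eval L mem a env - eval L mem b env
  | mul a b, env => eval L mem a env * eval L mem b env
  | ite c a b, env => if 0 < eval L mem c env then eval L mem a env else eval L mem b env
  | sum v e, env => ∑ i ∈ Finset.range L, eval L mem e (Function.update env v i)
  | prod v e, env => ∏ i ∈ Finset.range L, eval L mem e (Function.update env v i)
  | iter v x e, env =>
    descend (fun i a => clamp L (eval L mem e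
      (Function.update (Function.update env v i) x a))) L 0

/-- `W` bounds the length of the input and the sizes of the memory cells and variables. -/
structure Bounded (W L : ℕ) (mem env : ℕ → ℤ) : Prop where
  len : L ≤ W
  mem : ∀ x, bitLength (mem x) ≤ W + 1
  env : ∀ v, bitLength (env v) ≤ W + 1

theorem Bounded.update {W L : ℕ} {mem env : ℕ → ℤ} (h : Bounded W L mem env) (v : ℕ) {z : ℤ}
    (h0 : 0 ≤ z) (hz : z ≤ L) : Bounded W L mem (Function.update env v z) where
  len := h.len
  mem := h.mem
  env w := by
    have := h.len
    rcases eq_or_ne w v with rfl | hw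
    · simpa using bitLength_le_of_le h0 (by omega)
    · simpa [hw] using h.env w

/-- Sizes at most add under each arithmetic operation, and a sum or product has `L ≤ W` operands,
which multiplies the bound by `W`. An unrestricted iteration could square its value repeatedly; the
cut-off in `iter` is what keeps the bound polynomial. The polynomial depends on the expression
alone. -/
theorem exists_bitLength_eval_le (e : Term) : ∃ P : Polynomial ℕ, ∀ W L mem env,
    Bounded W L mem env → bitLength (e.eval L mem env) ≤ P.eval W := by
  induction e with
  | const z => exact ⟨.C (bitLength z), fun W L mem env h => by simp [eval]⟩
  | var v => exact ⟨.X + 1, fun W L mem env h => by simpa [eval] using h.env v⟩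
  | mem e => exact ⟨.X + 1, fun W L mem env h => by simpa [eval] using h.mem _⟩
  | add a b iha ihb =>
    obtain ⟨P, hP⟩ := iha
    obtain ⟨Q, hQ⟩ := ihb
    refine ⟨P + Q, fun W L mem env h => ?_⟩
    rw [Polynomial.eval_add]
    exact (bitLength_add_le _ _).trans (add_le_add (hP _ _ _ _ h) (hQ _ _ _ _ h))
  | sub a b iha ihb =>
    obtain ⟨P, hP⟩ := iha
    obtain ⟨Q, hQ⟩ := ihb
    refine ⟨P + Q, fun W L mem env h => ?_⟩
    rw [Polynomial.eval_add]
    exact (bitLength_sub_le _ _).trans (add_le_add (hP _ _ _ _ h) (hQ _ _ _ _ h))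
  | mul a b iha ihb =>
    obtain ⟨P, hP⟩ := iha
    obtain ⟨Q, hQ⟩ := ihb
    refine ⟨P + Q, fun W L mem env h => ?_⟩
    rw [Polynomial.eval_add]
    exact (bitLength_mul_le _ _).trans (add_le_add (hP _ _ _ _ h) (hQ _ _ _ _ h))
  | ite c a b _ iha ihb =>
    obtain ⟨P, hP⟩ := iha
    obtain ⟨Q, hQ⟩ := ihb
    refine ⟨P + Q, fun W L mem env h => ?_⟩
    rw [Polynomial.eval_add, eval]
    have h1 := hP _ _ _ _ h
    have h2 := hQ _ _ _ _ h
    split_ifs <;> omega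
  | sum v e ih =>
    obtain ⟨P, hP⟩ := ih
    refine ⟨.X * P + 2, fun W L mem env h => ?_⟩
    have key := descend_induction (f := fun i acc => acc + e.eval L mem (Function.update env v i))
      -- The summand `i * P.eval W` reserves room for the `i` terms still to be added; the constant
      -- `2` covers the length of the initial accumulator, for sums and products alike.
      (fun i acc => bitLength acc + i * P.eval W ≤ L * P.eval W + 2) (n := L) (a := 0)
      (by simp; omega) (fun i hi a ha => by
        have h1 := hP _ _ _ _ (h.update v (z := i) (by simp) (by omega))
        have h2 := bitLength_add_le a (e.eval L mem (Function.update env v i))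
        rw [add_mul] at ha
        omega)
    rw [descend_add] at key
    simp only [zero_add, zero_mul, add_zero] at key
    have h3 := Nat.mul_le_mul_right (P.eval W) h.len
    simp [eval]
    omega
  | prod v e ih =>
    obtain ⟨P, hP⟩ := ih
    refine ⟨.X * P + 2, fun W L mem env h => ?_⟩
    have key := descend_induction (f := fun i acc => acc * e.eval L mem (Function.update env v i))
      (fun i acc => bitLength acc + i * P.eval W ≤ L * P.eval W + 2) (n := L) (a := 1)
      (by simp [add_comm]) (fun i hi a ha => by
        have h1 := hP _ _ _ _ (h.update v (z := i) (by simp) (by omega))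
        have h2 := bitLength_mul_le a (e.eval L mem (Function.update env v i))
        rw [add_mul] at ha
        omega)
    rw [descend_mul] at key
    simp only [one_mul, zero_mul, add_zero] at key
    have h3 := Nat.mul_le_mul_right (P.eval W) h.len
    simp [eval]
    omega
  | iter v x e ih =>
    refine ⟨.X + 1, fun W L mem env h => ?_⟩
    have key := descend_induction (f := fun i a => clamp L (eval L mem e
      (Function.update (Function.update env v i) x a)))
      (fun _ a => 0 ≤ a ∧ a ≤ L) (n := L) (a := 0) (by simp)
      (fun i _ a _ => ⟨clamp_nonneg _ _, clamp_le _ _⟩)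
    have h3 := h.len
    simpa [eval] using bitLength_le_of_le key.1 (n := W) (by omega)

/-! ### Compilation -/

/-- Set register `d` to `z` and run `body` with register `d + 1` counting down. -/
def countdown (z : ℤ) (d : ℕ) (body : Prog) : Prog :=
  .seq (.const d z) <| .seq (.const (d + 1) 0) <| .seq (.add (d + 1) (d + 1) 0) <|
    .loop (d + 1) <| .seq (.const (d + 2) 1) <| .seq (.sub (d + 1) (d + 1) (d + 2)) body

/-- Register `d` receives register `d + 2`, cut off to `0` outside of the range from `0` to the
content of register `0`. -/
def clampProg (d : ℕ) : Prog :=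
  .seq (.const d 0) <| .seq (.const (d + 3) 1) <| .seq (.add (d + 3) (d + 3) 0) <|
    .seq (.sub (d + 3) (d + 3) (d + 2)) <|
    .ite (d + 2) (.ite (d + 3) (.add d d (d + 2)) (.const d 0)) (.const d 0)

/-- A program that writes the value of an expression into register `d`, uses otherwise only
registers above `d`, and finds the variable `v` in register `Γ v`. -/
def compile : Term → (ℕ → ℕ) → ℕ → Prog
  | const z, _, d => .const d z
  | var v, Γ, d => .seq (.const d 0) (.add d d (Γ v))
  | mem e, Γ, d => .seq (compile e Γ d) (.load d d)
  | add a b, Γ, d => .seq (compile a Γ d) (.seq (compile b Γ (d + 1)) (.add d d (d + 1)))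
  | sub a b, Γ, d => .seq (compile a Γ d) (.seq (compile b Γ (d + 1)) (.sub d d (d + 1)))
  | mul a b, Γ, d => .seq (compile a Γ d) (.seq (compile b Γ (d + 1)) (.mul d d (d + 1)))
  | ite c a b, Γ, d => .seq (compile c Γ d) (.ite d (compile a Γ d) (compile b Γ d))
  | sum v e, Γ, d => countdown 0 d
      (.seq (compile e (Function.update Γ v (d + 1)) (d + 2)) (.add d d (d + 2)))
  | prod v e, Γ, d => countdown 1 d
      (.seq (compile e (Function.update Γ v (d + 1)) (d + 2)) (.mul d d (d + 2)))
  | iter v x e, Γ, d => countdown 0 d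
      (.seq (compile e (Function.update (Function.update Γ v (d + 1)) x d) (d + 2))
        (clampProg d))

/-- `s'` arises from `s` by writing `z` into register `d` and changing registers above `d`. -/
structure Wrote (s : State) (d : ℕ) (z : ℤ) (s' : State) : Prop where
  mem : s'.mem = s.mem
  low : ∀ r < d, s'.reg r = s.reg r
  val : s'.reg d = z

/-- The variables are in the registers given by `Γ`, below `d`, and register `0` holds `L`. -/
structure Ready (L : ℕ) (env : ℕ → ℤ) (Γ : ℕ → ℕ) (d : ℕ) (s : State) : Prop where
  pos : 0 < d
  len : s.reg 0 = L
  lt : ∀ v, Γ v < d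
  val : ∀ v, s.reg (Γ v) = env v

theorem Ready.of_low {L : ℕ} {env : ℕ → ℤ} {Γ : ℕ → ℕ} {d d' : ℕ} {s s' : State}
    (h : Ready L env Γ d s) (hd : d ≤ d') (hlow : ∀ r < d, s'.reg r = s.reg r) :
    Ready L env Γ d' s' where
  pos := h.pos.trans_le hd
  len := by rw [hlow _ h.pos, h.len]
  lt v := (h.lt v).trans_le hd
  val v := by rw [hlow _ (h.lt v), h.val]

theorem Ready.update {L : ℕ} {env : ℕ → ℤ} {Γ : ℕ → ℕ} {d : ℕ} {s : State}
    (h : Ready L env Γ d s) (v : ℕ) {r : ℕ} (hr : r < d) {z : ℤ} (hz : s.reg r = z) :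
    Ready L (Function.update env v z) (Function.update Γ v r) d s where
  pos := h.pos
  len := h.len
  lt w := by
    rcases eq_or_ne w v with rfl | hw
    · simpa using hr
    · simpa [hw] using h.lt w
  val w := by
    rcases eq_or_ne w v with rfl | hw
    · simpa using hz
    · simpa [hw] using h.val w

theorem Wrote.trans {s s' s'' : State} {d d' : ℕ} {z w : ℤ} (h : Wrote s d' z s')
    (h' : Wrote s' d w s'') (hd : d ≤ d') : Wrote s d w s'' where
  mem := h'.mem.trans h.mem
  low r hr := (h'.low r hr).trans (h.low r (hr.trans_le hd))
  val := h'.val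

@[simp] theorem setReg_mem (s : State) (d : ℕ) (z : ℤ) : (s.setReg d z).mem = s.mem := rfl

@[simp] theorem setReg_reg (s : State) (d : ℕ) (z : ℤ) :
    (s.setReg d z).reg = Function.update s.reg d z := rfl

theorem Wrote.setReg (s : State) (d : ℕ) (z : ℤ) : Wrote s d z (s.setReg d z) where
  mem := rfl
  low r hr := by simp [hr.ne]
  val := by simp

/-- `A` is a side invariant of the accumulator. It supplies the size bound without which the body
could not have a uniform cost `T`. -/
theorem countdown_runs {z : ℤ} {d : ℕ} {body : Prog} {s : State} {L T W : ℕ}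
    {f : ℕ → ℤ → ℤ} (A : ℕ → ℤ → Prop) (hd : 0 < d) (hL : s.reg 0 = L) (hLW : L ≤ W)
    (hA : A L z)
    (hbody : ∀ i < L, ∀ (acc : ℤ) (s' : State), s'.mem = s.mem → (∀ r < d, s'.reg r = s.reg r) →
      s'.reg d = acc → s'.reg (d + 1) = (i : ℤ) → A (i + 1) acc →
      Runs body s' T fun s'' => s''.mem = s'.mem ∧ (∀ r < d, s''.reg r = s'.reg r) ∧
        s''.reg d = f i acc ∧ s''.reg (d + 1) = (i : ℤ) ∧ A i (f i acc)) :
    Runs (countdown z d body) s (bitLength z + 2 * W + 4 + W * (2 * W + 7 + T))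
      (Wrote s d (descend f L z)) := by
  have hB : ∀ i ≤ L, bitLength (i : ℤ) ≤ W + 1 := fun i hi =>
    bitLength_le_of_le (by simp) (by exact_mod_cast hi.trans hLW)
  -- The last conjunct says that the steps still to come turn the present accumulator into the final
  -- value; at `i = 0` it gives the result.
  let I : ℕ → State → Prop := fun i s' => s'.mem = s.mem ∧ (∀ r < d, s'.reg r = s.reg r) ∧
    s'.reg (d + 1) = (i : ℤ) ∧ A i (s'.reg d) ∧ descend f i (s'.reg d) = descend f L z
  have hloop : ∀ s', I L s' → Runs (.loop (d + 1) <| .seq (.const (d + 2) 1) <|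
      .seq (.sub (d + 1) (d + 1) (d + 2)) body) s' (L * (W + 1 + (2 + (W + 1 + 2 + T))) + (W + 1))
      (I 0) := by
    intro s' hs'
    refine Runs.loop L I (fun i s h => h.2.2.1) hB ?_ hs'
    intro i hi s1 ⟨hm, hlow, hc, hAi, hdesc⟩
    refine Runs.seq (R := fun t => t = s1.setReg (d + 2) 1) (Runs.const (by simp) rfl) ?_
    rintro _ rfl
    refine Runs.seq (R := fun t => t = (s1.setReg (d + 2) 1).setReg (d + 1) i)
      (Runs.sub ?_ ?_) ?_
    · have := hB (i + 1) (by omega)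
      simpa [hc] using this
    · simp [hc]
    rintro _ rfl
    refine (hbody i hi (s1.reg d) ((s1.setReg (d + 2) 1).setReg (d + 1) i) hm ?_ ?_ ?_
      hAi).mono le_rfl ?_
    · intro r hr
      rw [← hlow r hr]
      simp [show r ≠ d + 1 by omega, show r ≠ d + 2 by omega]
    · simp
    · simp
    · rintro s2 ⟨h1, h2, h3, h4, h5⟩
      refine ⟨h1.trans hm, ?_, h4, by rwa [h3], by rw [h3, ← hdesc]; rfl⟩
      intro r hr
      rw [h2 r hr, ← hlow r hr]
      simp [show r ≠ d + 1 by omega, show r ≠ d + 2 by omega]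
  have hall : Runs (countdown z d body) s (bitLength z + (1 + ((1 + (W + 1)) +
      (L * (W + 1 + (2 + (W + 1 + 2 + T))) + (W + 1))))) (I 0) := by
    refine Runs.seq (R := fun t => t = s.setReg d z) (Runs.const le_rfl rfl) ?_
    rintro _ rfl
    refine Runs.seq (R := fun t => t = (s.setReg d z).setReg (d + 1) 0)
      (Runs.const (by simp) rfl) ?_
    rintro _ rfl
    refine Runs.seq (R := I L) (Runs.add ?_ ?_) hloop
    · simpa [hd.ne, hL] using hB L le_rfl
    · refine ⟨rfl, ?_, ?_, ?_, ?_⟩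
      · intro r hr
        simp [show r ≠ d + 1 by omega, show r ≠ d by omega]
      · simp [hd.ne, hL]
      · simpa using hA
      · simp
  refine hall.mono ?_ ?_
  · have := Nat.mul_le_mul_right (2 * W + 7 + T) hLW
    have e1 : L * (W + 1 + (2 + (W + 1 + 2 + T))) ≤ L * (2 * W + 7 + T) :=
      Nat.mul_le_mul_left _ (by omega)
    omega
  · rintro s' ⟨h1, h2, h3, h4, h5⟩
    exact ⟨h1, h2, h5⟩

theorem clampProg_runs {d L W : ℕ} {s : State} {z : ℤ} (hd : 0 < d) (hL : s.reg 0 = L)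
    (hLW : L ≤ W) (hz : s.reg (d + 2) = z) :
    Runs (clampProg d) s (20 + 4 * W + 4 * bitLength z) fun s' => s'.mem = s.mem ∧
      (∀ r < d, s'.reg r = s.reg r) ∧ s'.reg d = clamp L z ∧ s'.reg (d + 1) = s.reg (d + 1) := by
  have hB : bitLength (L : ℤ) ≤ W + 1 :=
    bitLength_le_of_le (by simp) (by exact_mod_cast hLW)
  have hB1 : bitLength (1 + (L : ℤ)) ≤ W + 3 := by
    have := bitLength_add_le 1 (L : ℤ)
    simp at this
    omega
  have hB2 := bitLength_sub_le (1 + (L : ℤ)) z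
  have hall : Runs (clampProg d) s (1 + (2 + ((2 + (W + 1)) + ((W + 3 + bitLength z) +
      (bitLength z + ((W + 3 + bitLength z) + (1 + bitLength z)))))))
      fun s' => s'.mem = s.mem ∧ (∀ r < d, s'.reg r = s.reg r) ∧ s'.reg d = clamp L z ∧
        s'.reg (d + 1) = s.reg (d + 1) := by
    refine Runs.seq (R := fun t => t = s.setReg d 0) (Runs.const (by simp) rfl) ?_
    rintro _ rfl
    refine Runs.seq (R := fun t => t = (s.setReg d 0).setReg (d + 3) 1)
      (Runs.const (by simp) rfl) ?_
    rintro _ rfl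
    refine Runs.seq (R := fun t => t = ((s.setReg d 0).setReg (d + 3) 1).setReg (d + 3) (1 + L))
      (Runs.add (by simpa [hd.ne, hL] using hB) (by simp [hd.ne, hL])) ?_
    rintro _ rfl
    refine Runs.seq (R := fun t => t = (((s.setReg d 0).setReg (d + 3) 1).setReg (d + 3)
      (1 + L)).setReg (d + 3) (1 + L - z)) (Runs.sub (by simpa [hz] using hB1) (by simp [hz])) ?_
    rintro _ rfl
    set s0 := (((s.setReg d 0).setReg (d + 3) 1).setReg (d + 3) (1 + L)).setReg (d + 3)
      (1 + L - z) with hs0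
    have e2 : s0.reg (d + 2) = z := by simp [hs0, hz]
    have e3 : s0.reg (d + 3) = 1 + L - z := by simp [hs0]
    have e1 : s0.reg (d + 1) = s.reg (d + 1) := by simp [hs0]
    have e0 : s0.reg d = 0 := by simp [hs0]
    have elow : ∀ r < d, s0.reg r = s.reg r := fun r hr => by
      simp [hs0, show r ≠ d + 3 by omega, hr.ne]
    have em : s0.mem = s.mem := rfl
    have hset : ∀ w, (∀ r < d, (s0.setReg d w).reg r = s.reg r) := fun w r hr => by
      simp [hr.ne, elow r hr]
    refine (Runs.ite (T := (W + 3 + bitLength z) + (1 + bitLength z))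
      (fun hpos => ?_) (fun hneg => ?_)).mono ?_ fun s' h => h
    · refine (Runs.ite (T := 1 + bitLength z) (fun hpos' => ?_) (fun hneg' => ?_)).mono ?_
        fun s' h => h
      · refine Runs.add (by simp [e0, e2]) ⟨em, hset _, ?_, ?_⟩
        · rw [e2] at hpos
          rw [e3] at hpos'
          simp only [setReg_reg, Function.update_self, e0, e2, clamp, if_pos hpos,
            if_pos hpos', zero_add]
        · simp [e1]
      · refine Runs.const (by simp) ⟨em, hset _, ?_, ?_⟩
        · rw [e2] at hpos
          rw [e3] at hneg'
          simp only [setReg_reg, Function.update_self, clamp, if_pos hpos, if_neg hneg'.not_gt]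
        · simp [e1]
      · rw [e3]
        omega
    · refine Runs.const (by simp; omega) ⟨em, hset _, ?_, ?_⟩
      · rw [e2] at hneg
        simp [clamp, hneg.not_gt]
      · simp [e1]
    · rw [e2]
  exact hall.mono (by omega) fun _ h => h

/-- Subexpressions are evaluated in a stack discipline: code with target `d` leaves the memory and
all registers below `d` alone, so variables and pending operands survive. The size bounds on values
turn into cost bounds, and each loop multiplies the cost by about `W`. -/
theorem compile_runs (e : Term) : ∃ P : Polynomial ℕ, ∀ W L mem env Γ d s,
    Bounded W L mem env → Ready L env Γ d s → s.mem = mem →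
    Runs (compile e Γ d) s (P.eval W) (Wrote s d (e.eval L mem env)) := by
  have binary : ∀ (a b : Term) (op : ℕ → ℕ → ℕ → Prog) (f : ℤ → ℤ → ℤ),
      (∀ d a b s T Q, bitLength (s.reg a) + bitLength (s.reg b) ≤ T →
        Q (s.setReg d (f (s.reg a) (s.reg b))) → Runs (op d a b) s T Q) →
      (∃ P : Polynomial ℕ, ∀ W L mem env Γ d s,
        Bounded W L mem env → Ready L env Γ d s → s.mem = mem →
        Runs (compile a Γ d) s (P.eval W) (Wrote s d (a.eval L mem env))) →
      (∃ P : Polynomial ℕ, ∀ W L mem env Γ d s,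
        Bounded W L mem env → Ready L env Γ d s → s.mem = mem →
        Runs (compile b Γ d) s (P.eval W) (Wrote s d (b.eval L mem env))) →
      ∃ P : Polynomial ℕ, ∀ W L mem env Γ d s,
        Bounded W L mem env → Ready L env Γ d s → s.mem = mem →
        Runs (.seq (compile a Γ d) (.seq (compile b Γ (d + 1)) (op d d (d + 1)))) s (P.eval W)
          (Wrote s d (f (a.eval L mem env) (b.eval L mem env))) := by
    rintro a b op f hop ⟨P, hP⟩ ⟨Q, hQ⟩
    obtain ⟨P', hP'⟩ := exists_bitLength_eval_le a
    obtain ⟨Q', hQ'⟩ := exists_bitLength_eval_le b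
    refine ⟨P + (Q + (P' + Q')), fun W L mem env Γ d s hb hr hm => ?_⟩
    simp only [Polynomial.eval_add]
    refine Runs.seq (hP W L mem env Γ d s hb hr hm) fun s1 h1 => ?_
    refine Runs.seq (hQ W L mem env Γ (d + 1) s1 hb (hr.of_low (by omega) h1.low)
      (h1.mem.trans hm)) fun s2 h2 => ?_
    have e1 : s2.reg d = a.eval L mem env := by rw [h2.low d (by omega), h1.val]
    refine hop _ _ _ _ _ _ ?_ ?_
    · rw [e1, h2.val]
      exact add_le_add (hP' _ _ _ _ hb) (hQ' _ _ _ _ hb)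
    · rw [e1, h2.val]
      exact (h1.trans (h2.trans (Wrote.setReg ..) (by omega)) le_rfl)
  have accum : ∀ (v : ℕ) (e : Term) (z : ℤ) (op : ℕ → ℕ → ℕ → Prog) (f : ℤ → ℤ → ℤ),
      (∀ d a b s T Q, bitLength (s.reg a) + bitLength (s.reg b) ≤ T →
        Q (s.setReg d (f (s.reg a) (s.reg b))) → Runs (op d a b) s T Q) →
      (∀ a b, bitLength (f a b) ≤ bitLength a + bitLength b) →
      (∃ P : Polynomial ℕ, ∀ W L mem env Γ d s,
        Bounded W L mem env → Ready L env Γ d s → s.mem = mem →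
        Runs (compile e Γ d) s (P.eval W) (Wrote s d (e.eval L mem env))) →
      ∃ P : Polynomial ℕ, ∀ W L mem env Γ d s,
        Bounded W L mem env → Ready L env Γ d s → s.mem = mem →
        Runs (countdown z d (.seq (compile e (Function.update Γ v (d + 1)) (d + 2))
          (op d d (d + 2)))) s (P.eval W)
          (Wrote s d (descend (fun i acc => f acc (e.eval L mem (Function.update env v i)))
            L z)) := by
    rintro v e z op f hop hsize ⟨P, hP⟩
    obtain ⟨Q, hQ⟩ := exists_bitLength_eval_le e
    -- The bound of `countdown_runs`, where the body costs `P` for the new operand and then the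
    -- combined size of the accumulator, at most `W * Q` plus the size of `z`, and of the operand,
    -- at most `Q`.
    refine ⟨.C (bitLength z) + 2 * .X + 4 +
      .X * (2 * .X + 7 + (P + (.X * Q + .C (bitLength z) + Q))),
      fun W L mem env Γ d s hb hr hm => ?_⟩
    have hT := Nat.mul_le_mul_right (Q.eval W) hb.len
    simp only [Polynomial.eval_add, Polynomial.eval_mul, Polynomial.eval_C, Polynomial.eval_X,
      Polynomial.eval_ofNat]
    refine countdown_runs (A := fun i acc => bitLength acc + i * Q.eval W ≤
      L * Q.eval W + bitLength z) hr.pos hr.len hb.len (by rw [add_comm]) ?_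
    intro i hi acc s1 hm1 hlow1 hd1 hc1 hA
    have hb' := hb.update v (z := i) (by simp) (by omega)
    refine Runs.seq (hP W L mem _ _ (d + 2) s1 hb'
      ((hr.of_low (by omega) hlow1).update v (by omega) hc1) (hm1.trans hm)) fun s2 h2 => ?_
    have e1 : s2.reg d = acc := by rw [h2.low d (by omega), hd1]
    have hQ1 := hQ _ _ _ _ hb'
    refine hop _ _ _ _ _ _ ?_ ⟨h2.mem, ?_, ?_, ?_, ?_⟩
    · rw [e1, h2.val]
      omega
    · intro r hr
      simp [hr.ne, h2.low r (by omega)]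
    · simp [e1, h2.val]
    · simp [h2.low (d + 1) (by omega), hc1]
    · have := hsize acc (e.eval L mem (Function.update env v i))
      rw [add_mul] at hA
      omega
  induction e with
  | const z =>
    refine ⟨.C (bitLength z), fun W L mem env Γ d s hb hr hm => ?_⟩
    exact Runs.const (by simp) (Wrote.setReg ..)
  | var v =>
    refine ⟨1 + (1 + (.X + 1)), fun W L mem env Γ d s hb hr hm => ?_⟩
    simp only [Polynomial.eval_add, Polynomial.eval_one, Polynomial.eval_X]
    have hv := hr.lt v
    refine Runs.seq (Runs.const (Q := Wrote s d 0) (by simp) (Wrote.setReg ..)) fun s1 h1 => ?_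
    have e1 : s1.reg (Γ v) = env v := by rw [h1.low _ hv, hr.val]
    refine Runs.add ?_ ?_
    · rw [e1, h1.val, bitLength_zero]
      have := hb.env v
      omega
    · rw [e1, h1.val, zero_add]
      exact h1.trans (Wrote.setReg ..) le_rfl
  | mem e ih =>
    obtain ⟨P, hP⟩ := ih
    obtain ⟨Q, hQ⟩ := exists_bitLength_eval_le e
    refine ⟨P + (Q + (.X + 1)), fun W L mem env Γ d s hb hr hm => ?_⟩
    simp only [Polynomial.eval_add, Polynomial.eval_one, Polynomial.eval_X]
    refine Runs.seq (hP W L mem env Γ d s hb hr hm) fun s1 h1 => ?_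
    refine Runs.load ?_ ?_
    · rw [h1.val, h1.mem, hm]
      exact add_le_add (hQ _ _ _ _ hb) (hb.mem _)
    · rw [h1.val, h1.mem, hm]
      exact h1.trans (Wrote.setReg ..) le_rfl
  | add a b iha ihb =>
    exact binary a b .add (· + ·) (fun _ _ _ _ _ _ h h' => Runs.add h h') iha ihb
  | sub a b iha ihb =>
    exact binary a b .sub (· - ·) (fun _ _ _ _ _ _ h h' => Runs.sub h h') iha ihb
  | mul a b iha ihb =>
    exact binary a b .mul (· * ·) (fun _ _ _ _ _ _ h h' => Runs.mul h h') iha ihb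
  | ite c a b ihc iha ihb =>
    obtain ⟨C, hC⟩ := ihc
    obtain ⟨C', hC'⟩ := exists_bitLength_eval_le c
    obtain ⟨P, hP⟩ := iha
    obtain ⟨Q, hQ⟩ := ihb
    refine ⟨C + (C' + (P + Q)), fun W L mem env Γ d s hb hr hm => ?_⟩
    simp only [Polynomial.eval_add]
    refine Runs.seq (hC W L mem env Γ d s hb hr hm) fun s1 h1 => ?_
    refine (Runs.ite (fun h => ?_) (fun h => ?_)).mono
      (Nat.add_le_add_right (by rw [h1.val]; exact hC' _ _ _ _ hb) _) (fun _ h => h)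
    · refine (hP W L mem env Γ d s1 hb (hr.of_low le_rfl h1.low) (h1.mem.trans hm)).mono
        (by omega) fun s2 h2 => ?_
      rw [h1.val] at h
      rw [eval, if_pos h]
      exact h1.trans h2 le_rfl
    · refine (hQ W L mem env Γ d s1 hb (hr.of_low le_rfl h1.low) (h1.mem.trans hm)).mono
        (by omega) fun s2 h2 => ?_
      rw [h1.val] at h
      rw [eval, if_neg h.not_gt]
      exact h1.trans h2 le_rfl
  | sum v e ih =>
    obtain ⟨P, hP⟩ := accum v e 0 .add (· + ·) (fun _ _ _ _ _ _ h h' => Runs.add h h')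
      bitLength_add_le ih
    refine ⟨P, fun W L mem env Γ d s hb hr hm => ?_⟩
    have := hP W L mem env Γ d s hb hr hm
    rwa [descend_add, zero_add] at this
  | prod v e ih =>
    obtain ⟨P, hP⟩ := accum v e 1 .mul (· * ·) (fun _ _ _ _ _ _ h h' => Runs.mul h h')
      bitLength_mul_le ih
    refine ⟨P, fun W L mem env Γ d s hb hr hm => ?_⟩
    have := hP W L mem env Γ d s hb hr hm
    rwa [descend_mul, one_mul] at this
  | iter v x e ih =>
    obtain ⟨P, hP⟩ := ih
    obtain ⟨Q, hQ⟩ := exists_bitLength_eval_le e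
    refine ⟨1 + 2 * .X + 4 + .X * (2 * .X + 7 + (P + (20 + 4 * .X + 4 * Q))),
      fun W L mem env Γ d s hb hr hm => ?_⟩
    simp only [Polynomial.eval_add, Polynomial.eval_mul, Polynomial.eval_X,
      Polynomial.eval_ofNat, Polynomial.eval_one]
    rw [show 1 + 2 * W + 4 = bitLength 0 + 2 * W + 4 by simp]
    refine countdown_runs (f := fun i a => clamp L (eval L mem e
      (Function.update (Function.update env v i) x a))) (A := fun _ a => 0 ≤ a ∧ a ≤ L)
      hr.pos hr.len hb.len (by simp) ?_
    intro i hi acc s1 hm1 hlow1 hd1 hc1 hA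
    have hb' := (hb.update v (z := i) (by simp) (by omega)).update x hA.1 hA.2
    have hr1 := hr.of_low (d' := d + 2) (by omega) hlow1
    refine Runs.seq (hP W L mem _ _ (d + 2) s1 hb'
      ((hr1.update v (by omega) hc1).update x (by omega) hd1) (hm1.trans hm)) fun s2 h2 => ?_
    have hQ1 := hQ _ _ _ _ hb'
    refine (clampProg_runs hr.pos (by rw [h2.low 0 (by omega), hr1.len]) hb.len h2.val).mono
      (by omega) ?_
    rintro s3 ⟨h3, h4, h5, h6⟩
    refine ⟨h3.trans h2.mem, fun r hr => (h4 r hr).trans (h2.low r (by omega)), h5, ?_,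
      clamp_nonneg _ _, clamp_le _ _⟩
    rw [h6, h2.low _ (by omega), hc1]

end Term

/-! ### Problems that are solved by a pair of expressions -/

theorem length_le_inputSize (l : List ℤ) : l.length ≤ inputSize l := by
  induction l with
  | nil => simp
  | cons a l ih =>
    have := bitLength_pos a
    simp [inputSize] at *
    omega

theorem bitLength_getD_le (l : List ℤ) (x : ℕ) : bitLength (l.getD x 0) ≤ inputSize l + 1 := by
  by_cases h : x < l.length
  · rw [List.getD_eq_getElem _ _ h]
    exact (List.single_le_sum (by simp) _ (List.mem_map_of_mem (List.getElem_mem h))).trans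
      (Nat.le_succ _)
  · rw [List.getD_eq_default _ _ (by omega)]
    simp

theorem solvableInPolyTime_of_terms {α : Type*} {encode : α → List ℤ}
    {IsAnswer : α → List ℤ → Prop} (a b : Term)
    (h : ∀ x, IsAnswer x
      [a.eval (encode x).length (fun i => (encode x).getD i 0) 0,
       b.eval (encode x).length (fun i => (encode x).getD i 0) 0]) :
    SolvableInPolyTime encode IsAnswer := by
  obtain ⟨P, hP⟩ := a.compile_runs
  obtain ⟨P', hP'⟩ := Term.exists_bitLength_eval_le a
  obtain ⟨Q, hQ⟩ := b.compile_runs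
  obtain ⟨Q', hQ'⟩ := Term.exists_bitLength_eval_le b
  -- Register `1` is initially `0` and lies below both targets, so it serves every free variable.
  -- The second target is `3`, so that register `2` keeps the first value. Memory is overwritten
  -- only after both evaluations, which read the input from it.
  refine ⟨.seq (a.compile (fun _ => 1) 2) <| .seq (b.compile (fun _ => 1) 3) <|
    .seq (.const 4 0) <| .seq (.store 4 2) <| .seq (.const 4 1) <| .seq (.store 4 3) <|
    .const 0 2, P + (Q + (1 + (1 + P' + (2 + (2 + Q' + 3))))), fun x => ?_⟩
  set l := encode x
  set mem := fun i => l.getD i 0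
  have hb : Term.Bounded (inputSize l) l.length mem 0 :=
    ⟨length_le_inputSize l, bitLength_getD_le l, fun v => by simp⟩
  have hr : Term.Ready l.length 0 (fun _ => 1) 2 (input l) :=
    ⟨by omega, by simp [input], by simp, by simp [input]⟩
  have main : Runs (.seq (a.compile (fun _ => 1) 2) <| .seq (b.compile (fun _ => 1) 3) <|
      .seq (.const 4 0) <| .seq (.store 4 2) <| .seq (.const 4 1) <| .seq (.store 4 3) <|
      .const 0 2) (input l)
      ((P + (Q + (1 + (1 + P' + (2 + (2 + Q' + 3)))))).eval (inputSize l))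
      fun s => output s = [a.eval l.length mem 0, b.eval l.length mem 0] := by
    simp only [Polynomial.eval_add, Polynomial.eval_ofNat, Polynomial.eval_one]
    refine Runs.seq (hP _ _ _ _ _ _ _ hb hr rfl) fun s1 h1 => ?_
    refine Runs.seq (hQ _ _ _ _ _ 3 _ hb (hr.of_low (by omega) h1.low) h1.mem) fun s2 h2 => ?_
    have e2 : s2.reg 2 = a.eval l.length mem 0 := by rw [h2.low 2 (by omega), h1.val]
    refine Runs.seq (R := fun t => t = s2.setReg 4 0) (Runs.const (by simp) rfl) ?_
    rintro _ rfl
    refine Runs.seq (R := fun t => t = (s2.setReg 4 0).setMem 0 (a.eval l.length mem 0))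
      (Runs.store ?_ ?_) ?_
    · simpa [e2] using hP' _ _ _ _ hb
    · simp [e2]
    rintro _ rfl
    refine Runs.seq (R := fun t => t = ((s2.setReg 4 0).setMem 0
      (a.eval l.length mem 0)).setReg 4 1) (Runs.const (by simp) rfl) ?_
    rintro _ rfl
    refine Runs.seq (R := fun t => t = (((s2.setReg 4 0).setMem 0
      (a.eval l.length mem 0)).setReg 4 1).setMem 1 (b.eval l.length mem 0))
      (Runs.store ?_ ?_) ?_
    · simpa [State.setMem, h2.val] using hQ' _ _ _ _ hb
    · simp [State.setMem, h2.val]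
    rintro _ rfl
    refine Runs.const (by decide) ?_
    simp [output, State.setMem, List.range_succ]
  obtain ⟨t, s, he, ht, hs⟩ := main
  exact ⟨t, s, he, ht, hs ▸ h x⟩

end RAM

namespace Ranking

/-! ### Positions in the ranking -/

/-- Stable sorting is the order isomorphism onto the pairs `(f i, i)` in lexicographic order, so a
position is the number of smaller pairs. -/
theorem sort_symm_apply {n : ℕ} {α : Type*} [LinearOrder α] (f : Fin n → α) (i : Fin n) :
    ((Tuple.sort f).symm i : ℕ) =
      (Finset.univ.filter fun i' => f i' < f i ∨ f i' = f i ∧ i' < i).card := by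
  set σ := Tuple.sort f with hσ
  have key : ∀ a b : Fin n, a < b ↔ f (σ a) < f (σ b) ∨ f (σ a) = f (σ b) ∧ σ a < σ b := by
    intro a b
    rw [← (Tuple.graphEquiv₂ f).lt_iff_lt, ← Subtype.coe_lt_coe, Prod.Lex.lt_iff,
      Tuple.graphEquiv₂_apply, Tuple.graphEquiv₂_apply]
    rfl
  have h : (Finset.univ.filter fun i' => f i' < f i ∨ f i' = f i ∧ i' < i) =
      (Finset.Iio (σ.symm i)).map σ.toEmbedding := by
    ext i'
    obtain ⟨a, rfl⟩ := σ.surjective i'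
    have := key a (σ.symm i)
    rw [σ.apply_symm_apply] at this
    simp [this]
  rw [h, Finset.card_map, Fin.card_Iio]

section Rows

variable {n m : ℕ} (M : Matrix (Fin n) (Fin m) ℚ) (i : Fin n)

/-- The rows that are ranked before row `i`. -/
def before : Finset (Fin n) :=
  Finset.univ.filter fun i' => maxScore (M i) < maxScore (M i') ∨
    maxScore (M i') = maxScore (M i) ∧ i' < i

theorem maxDsc_apply : (maxDsc M i : ℕ) = (before M i).card := by
  rw [maxDsc, sort_symm_apply]
  simp [before]

variable {M i}

theorem coe_lt_maxScore {v : ℚ} {row : Fin m → ℚ} :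
    (v : WithBot ℚ) < maxScore row ↔ ∃ j, v < row j := by
  simp [maxScore, Finset.lt_sup_iff]

theorem coe_le_maxScore {v : ℚ} {row : Fin m → ℚ} :
    (v : WithBot ℚ) ≤ maxScore row ↔ ∃ j, v ≤ row j := by
  simp [maxScore, Finset.le_sup_iff (WithBot.bot_lt_coe v)]

theorem maxScore_eq {row : Fin m → ℚ} {j : Fin m} (h : ∀ j', row j' ≤ row j) :
    maxScore row = row j := by
  refine le_antisymm (Finset.sup_le fun j' _ => ?_) (coe_le_maxScore.2 ⟨j, le_rfl⟩)
  exact_mod_cast h j'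

theorem mem_before_iff {j : Fin m} (h : ∀ j', M i j' ≤ M i j) {i' : Fin n} :
    i' ∈ before M i ↔ ∃ j', M i j < M i' j' ∨ M i j = M i' j' ∧ i' < i := by
  simp only [before, Finset.mem_filter, Finset.mem_univ, true_and, maxScore_eq h]
  constructor
  · rintro (h1 | ⟨h1, h2⟩)
    · obtain ⟨j', hj'⟩ := coe_lt_maxScore.1 h1
      exact ⟨j', .inl hj'⟩
    · obtain ⟨j', hj'⟩ := coe_le_maxScore.1 h1.ge
      rcases hj'.lt_or_eq with h3 | h3
      · exact ⟨j', .inl h3⟩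
      · exact ⟨j', .inr ⟨h3, h2⟩⟩
  · rintro ⟨j', h1 | ⟨h1, h2⟩⟩
    · exact .inl (coe_lt_maxScore.2 ⟨j', h1⟩)
    · rcases (coe_le_maxScore.2 ⟨j', h1.le⟩ : (M i j : WithBot ℚ) ≤ maxScore (M i')).lt_or_eq
        with h3 | h3
      · exact .inl h3
      · exact .inr ⟨h3.symm, h2⟩

/-- Quantifying over all columns `j` replaces knowledge of where row `i` is maximal, so the
condition can be evaluated as a sum of products. A column is needed: without columns no witness `j'`
exists, yet ties may still put rows before `i`. -/
theorem mem_before_iff_forall [Nonempty (Fin m)] {i' : Fin n} :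
    i' ∈ before M i ↔ ∃ j', ∀ j, M i j < M i' j' ∨ M i j = M i' j' ∧ i' < i := by
  obtain ⟨j₀, -, h⟩ := Finset.univ.exists_max_image (M i) Finset.univ_nonempty
  have h' : ∀ j, M i j ≤ M i j₀ := fun j => h j (Finset.mem_univ j)
  rw [mem_before_iff h']
  refine exists_congr fun j' => ⟨fun hj j => ?_, fun hj => hj j₀⟩
  have := h' j
  rcases hj with h1 | ⟨h1, h2⟩
  · exact .inl (this.trans_lt h1)
  · rcases this.lt_or_eq with h3 | h3
    · exact .inl (h1 ▸ h3)
    · exact .inr ⟨h3.trans h1, h2⟩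

/-- The value `x`, in row `i'` and column `j'`, does not contradict that row `i` has its leftmost
maximum `y` in column `j` and is ranked before row `i'`. -/
def Conforms (x y : ℚ) (i : Fin n) (j : Fin m) (i' : Fin n) (j' : Fin m) : Prop :=
  x < y ∨ x = y ∧ (i < i' ∨ i = i' ∧ j ≤ j')

instance decidableConforms (x y : ℚ) (i : Fin n) (j : Fin m) (i' : Fin n) (j' : Fin m) :
    Decidable (Conforms x y i j i' j') :=
  inferInstanceAs (Decidable (x < y ∨ x = y ∧ (i < i' ∨ i = i' ∧ j ≤ j')))

open Classical in
/-- The rows with an entry that does not conform to `X i j`. -/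
noncomputable def violating (X : Matrix (Fin n) (Fin m) ℚ) (i : Fin n) (j : Fin m) :
    Finset (Fin n) :=
  Finset.univ.filter fun i' => ∃ j', ¬ Conforms (X i' j') (X i j) i j i' j'

theorem mem_violating {X : Matrix (Fin n) (Fin m) ℚ} {i i' : Fin n} {j : Fin m} :
    i' ∈ violating X i j ↔ ∃ j', ¬ Conforms (X i' j') (X i j) i j i' j' := by
  simp only [violating, Finset.mem_filter, Finset.mem_univ, true_and]

/-- If row `i` itself does not violate, then `M i j` is its maximum. The comparison of columns in
`Conforms` concerns only row `i`; for any other row, failing to conform means exceeding the maximum,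
or equalling it with a smaller index. -/
theorem violating_eq_before {j : Fin m} (h : i ∉ violating M i j) :
    violating M i j = before M i := by
  have h' : ∀ j', M i j' ≤ M i j := fun j' => by
    rw [mem_violating] at h
    push Not at h
    rcases h j' with h1 | h1
    exacts [h1.le, h1.1.le]
  ext i'
  rcases eq_or_ne i' i with rfl | hi
  · refine iff_of_false h ?_
    simp [mem_before_iff h', h']
  · rw [mem_before_iff h', mem_violating]
    simp only [Conforms]
    refine exists_congr fun j' => ?_
    rcases lt_trichotomy (M i' j') (M i j) with h1 | h1 | h1
    · simp [h1, h1.not_gt, h1.ne']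
    · simp [h1, hi.symm, lt_iff_le_and_ne, hi]
    · simp [h1, h1.not_gt, h1.ne']

/-- The column is the one maximizing the pair of value and reversed column index in lexicographic
order; the pairs are distinct, so the maximum is attained once. -/
theorem existsUnique_notMem_violating [Nonempty (Fin m)] : ∃! j, i ∉ violating M i j := by
  have key : ∀ j, i ∉ violating M i j ↔
      ∀ j', toLex (M i j', OrderDual.toDual j') ≤ toLex (M i j, OrderDual.toDual j) := fun j => by
    rw [mem_violating]
    push Not
    simp only [Conforms, lt_irrefl, false_or, true_and, Prod.Lex.le_iff, ofLex_toLex,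
      OrderDual.toDual_le_toDual]
  obtain ⟨j, -, h⟩ := Finset.univ.exists_max_image
    (fun j => toLex (M i j, OrderDual.toDual j)) Finset.univ_nonempty
  refine ⟨j, (key j).2 fun j' => h j' (Finset.mem_univ _), fun j₁ h₁ => ?_⟩
  have := le_antisymm (h j₁ (Finset.mem_univ _)) ((key j₁).1 h₁ j)
  simpa using congrArg (fun x => (ofLex x).2) this

theorem sum_violating [Nonempty (Fin m)] (K : ℕ) :
    ∑ j, (if i ∉ violating M i j then if (violating M i j).card ≤ K then 1 else 0 else 0) =
      (if (before M i).card ≤ K then 1 else 0 : ℤ) := by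
  obtain ⟨j, h, huniq⟩ := existsUnique_notMem_violating (n := n) (m := m) (M := M) (i := i)
  rw [Finset.sum_eq_single j (fun j' _ hj' => if_neg fun h' => hj' (huniq j' h')) (by simp),
    if_pos h, violating_eq_before h]

end Rows

/-! ### Counting by inclusion and exclusion -/

/-- Erasing `b` changes the truth of `card ≤ l` only if `b ∈ S` and `S.card = l + 1`. In that case
exactly `l + 1` elements contribute, and this factor is absorbed in the factorial, so no division is
needed. -/
theorem card_le_succ_recursion {α : Type*} [Fintype α] [DecidableEq α] (S : Finset α) (l : ℕ) :
    ((l + 1).factorial : ℤ) * (if S.card ≤ l + 1 then 1 else 0) =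
      (l + 1) * (l.factorial * (if S.card ≤ l then 1 else 0)) +
        ∑ b, (l.factorial * (if (S.erase b).card ≤ l then 1 else 0) -
          l.factorial * (if S.card ≤ l then 1 else 0) : ℤ) := by
  have h : ∀ b, (l.factorial * (if (S.erase b).card ≤ l then 1 else 0) -
      l.factorial * (if S.card ≤ l then 1 else 0) : ℤ) =
      if b ∈ S then (l.factorial * (if S.card = l + 1 then 1 else 0) : ℤ) else 0 := by
    intro b
    by_cases hb : b ∈ S
    · have := Finset.card_pos.2 ⟨b, hb⟩
      rw [Finset.card_erase_of_mem hb, if_pos hb]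
      split_ifs <;> omega
    · rw [Finset.erase_eq_of_notMem hb, if_neg hb, sub_self]
  simp only [h]
  rw [Finset.sum_ite_mem, Finset.univ_inter, Finset.sum_const, nsmul_eq_mul, Nat.factorial_succ]
  push_cast
  rcases lt_trichotomy S.card (l + 1) with h1 | h1 | h1
  · rw [if_pos h1.le, if_pos (by omega), if_neg h1.ne]; ring
  · rw [if_pos h1.le, if_neg (by omega), if_pos h1, h1]; push_cast; ring
  · rw [if_neg (by omega), if_neg (by omega), if_neg (by omega)]; ring

/-- Independence in the form of the distributive law: read from right to left, an exponentially long
sum becomes a product of short ones. -/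
theorem prod_sum_ite {ι : Type*} [Fintype ι] [DecidableEq ι] {κ : ι → Type*}
    [∀ j, Fintype (κ j)] (w : ∀ j, κ j → ℤ) (p : ∀ j, κ j → Prop) [∀ j, DecidablePred (p j)]
    [DecidablePred fun c : ∀ j, κ j => ∀ j, p j (c j)] :
    ∏ j, ∑ c, (if p j c then 1 else 0) * w j c =
      ∑ c : ∀ j, κ j, (∏ j, w j (c j)) * if ∀ j, p j (c j) then 1 else 0 := by
  rw [Finset.prod_univ_sum, Fintype.piFinset_univ]
  refine Finset.sum_congr rfl fun c _ => ?_
  rw [Finset.prod_mul_distrib, mul_comm]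
  congr 1
  convert Fintype.prod_boole

/-! ### Common denominators -/

theorem div_lt_div_iff_int {A B C D : ℤ} (hB : B ≠ 0) (hD : D ≠ 0) :
    0 < (C * B - A * D) * (B * D) ↔ (A / B : ℚ) < C / D := by
  have hB' : (B : ℚ) ≠ 0 := by exact_mod_cast hB
  have hD' : (D : ℚ) ≠ 0 := by exact_mod_cast hD
  -- Multiplying by a square makes the comparison insensitive to the signs of the denominators,
  -- which may be negative.
  have h : (C / D - A / B : ℚ) * (B * D) ^ 2 = (C * B - A * D) * (B * D) := by
    field_simp
  have hpos : (0 : ℚ) < (B * D) ^ 2 := by positivity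
  rw [← sub_pos (b := (A / B : ℚ)), ← mul_pos_iff_of_pos_right hpos, h]
  exact_mod_cast Iff.rfl

theorem div_eq_div_iff_int {A B C D : ℤ} (hB : B ≠ 0) (hD : D ≠ 0) :
    (C * B - A * D) * (B * D) = 0 ↔ (A / B : ℚ) = C / D := by
  have hB' : (B : ℚ) ≠ 0 := by exact_mod_cast hB
  have hD' : (D : ℚ) ≠ 0 := by exact_mod_cast hD
  rw [div_eq_div_iff hB' hD', mul_eq_zero, or_iff_left (mul_ne_zero hB hD), sub_eq_zero]
  norm_cast
  exact eq_comm

/-- For an integer `x`, adding `1` makes it positive exactly when `x ≥ 0`; so the tie-break becomes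
a summand `0` or `1`. -/
theorem cross_pos_iff {A B C D : ℤ} (hB : B ≠ 0) (hD : D ≠ 0) (p : Prop) [Decidable p] :
    0 < (C * B - A * D) * (B * D) + (if p then 1 else 0) ↔
      (A / B : ℚ) < C / D ∨ (A / B : ℚ) = C / D ∧ p := by
  rw [← div_lt_div_iff_int hB hD, ← div_eq_div_iff_int hB hD]
  by_cases h : p <;> simp only [h, if_true, if_false, and_true, and_false, or_false] <;> omega

namespace Instance

variable (I : Instance)

/-- A choice of one pair from each of the distributions. -/
abbrev Choice : Type := (j : Fin I.m) → Fin (I.dist j).pairs.length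

/-- The numerator of a probability over the product of all the denominators in its list. -/
def weight (j : Fin I.m) (c : Fin (I.dist j).pairs.length) : ℤ :=
  ((I.dist j).pairs.get c).2.num *
    ∏ c', if c' ≠ c then ((I.dist j).pairs.get c').2.den else 1

/-- The product of the denominators of all probabilities. -/
def denProd : ℤ := ∏ j, ∏ c, ((I.dist j).pairs.get c).2.den

theorem denProd_ne_zero : I.denProd ≠ 0 :=
  Finset.prod_ne_zero_iff.2 fun _ _ => Finset.prod_ne_zero_iff.2 fun _ _ => Frac.den_ne_zero _

/-- In each column the missing denominator in `weight` is that of the chosen probability, so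
`weight` is the probability times a factor independent of the choice. -/
theorem prod_weight (c : I.Choice) :
    ((∏ j, I.weight j (c j) : ℤ) : ℚ) = (∏ j, (I.dist j).prob (c j)) * I.denProd := by
  simp only [denProd, Int.cast_prod, ← Finset.prod_mul_distrib]
  refine Finset.prod_congr rfl fun j _ => ?_
  have h : (((I.dist j).pairs.get (c j)).2.den : ℚ) ≠ 0 := by
    exact_mod_cast Frac.den_ne_zero _
  rw [← Finset.mul_prod_erase Finset.univ _ (Finset.mem_univ (c j)), FinDist.prob, Frac.toRat,
    ← mul_assoc, div_mul_cancel₀ _ h, weight, Int.cast_mul, Int.cast_prod,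
    ← Finset.mul_prod_erase Finset.univ _ (Finset.mem_univ (c j))]
  simp only [ne_eq, not_true_eq_false, if_false, Int.cast_one, one_mul]
  congr 1
  refine Finset.prod_congr rfl fun c' hc' => ?_
  rw [if_pos (Finset.ne_of_mem_erase hc')]

theorem sum_prob : ∑ c : I.Choice, ∏ j, (I.dist j).prob (c j) = 1 := by
  rw [← Fintype.piFinset_univ, ← Finset.prod_univ_sum]
  refine Finset.prod_eq_one fun j _ => ?_
  rw [← (I.dist j).prob_sum, ← Fin.sum_univ_fun_getElem]
  rfl

end Instance

end Ranking

/-! ### Indexing into concatenated blocks -/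

theorem List.getD_flatMap {α β : Type*} (f : α → List β) (d : β) (l : List α) (i : ℕ)
    (hi : i < l.length) {r : ℕ} (hr : r < (f l[i]).length) :
    (l.flatMap f).getD (((l.take i).map fun a => (f a).length).sum + r) d =
      (f l[i]).getD r d := by
  induction l generalizing i with
  | nil => simp at hi
  | cons a l ih =>
    rw [List.flatMap_cons]
    cases i with
    | zero =>
      simp only [List.take_zero, List.map_nil, List.sum_nil, zero_add]
      exact List.getD_append _ _ _ _ hr
    | succ i =>
      rw [List.take_succ_cons, List.map_cons, List.sum_cons,
        List.getD_append_right _ _ _ _ (by omega), add_assoc, Nat.add_sub_cancel_left]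
      exact ih i (by simpa using hi) hr

theorem List.getD_flatMap_of_length_eq {α β : Type*} (f : α → List β) (d : β) (l : List α) {q : ℕ}
    (h : ∀ a, (f a).length = q) (i : ℕ) (hi : i < l.length) {r : ℕ} (hr : r < q) :
    (l.flatMap f).getD (i * q + r) d = (f l[i]).getD r d := by
  rw [← List.getD_flatMap f d l i hi (by rwa [h])]
  simp only [h, List.map_const', List.sum_replicate, List.length_take, min_eq_left hi.le,
    smul_eq_mul]

namespace Ranking

/-! ### The layout of an instance in the memory -/

@[simp] theorem Frac.length_encode (q : Frac) : q.encode.length = 2 := rfl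

theorem FinDist.length_encode (D : FinDist) : D.encode.length = 1 + 4 * D.pairs.length := by
  simp [FinDist.encode, List.length_flatMap, mul_comm, add_comm]

theorem FinDist.getD_encode (D : FinDist) (c : Fin D.pairs.length) {r : ℕ} (hr : r < 4) :
    D.encode.getD (1 + r + 4 * c) 0 =
      [(D.pairs.get c).1.num, (D.pairs.get c).1.den, (D.pairs.get c).2.num,
        (D.pairs.get c).2.den].getD r 0 := by
  have h := List.getD_flatMap_of_length_eq
    (fun vp : Frac × Frac => vp.1.encode ++ vp.2.encode) 0 D.pairs (fun _ => rfl) c c.2 hr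
  rw [FinDist.encode, show 1 + r + 4 * (c : ℕ) = (c * 4 + r) + 1 by ring, List.getD_cons_succ, h]
  rfl

namespace Instance

variable (I : Instance)

/-- The content of the memory cells at the start. -/
def mem (x : ℕ) : ℤ := I.encode.getD x 0

/-- The first memory cell that belongs to the distribution `j`. -/
def start (j : ℕ) : ℕ :=
  3 + 2 * (I.n * I.m) +
    (((List.finRange I.m).take j).map fun j' => (I.dist j').encode.length).sum

theorem length_entries_row (i : Fin I.n) :
    ((List.finRange I.m).flatMap fun j => (I.entry i j).encode).length = 2 * I.m := by
  simp [List.length_flatMap, mul_comm]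

theorem length_entries : ((List.finRange I.n).flatMap fun i =>
    (List.finRange I.m).flatMap fun j => (I.entry i j).encode).length = 2 * (I.n * I.m) := by
  rw [List.length_flatMap]
  simp only [length_entries_row]
  simp
  ring

theorem mem_entry (i : Fin I.n) (j : Fin I.m) {r : ℕ} (hr : r < 2) :
    I.mem (3 + 2 * (i * I.m + j) + r) = [(I.entry i j).num, (I.entry i j).den].getD r 0 := by
  have h1 := List.getD_flatMap_of_length_eq (fun j => (I.entry i j).encode) 0
    (List.finRange I.m) (fun _ => rfl) j (by simp) hr
  have hj := j.2
  have hi : (i + 1) * I.m ≤ I.n * I.m := Nat.mul_le_mul_right _ i.2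
  rw [add_mul] at hi
  have h2 := List.getD_flatMap_of_length_eq (fun i => (List.finRange I.m).flatMap fun j =>
    (I.entry i j).encode) 0 (List.finRange I.n) (fun i => I.length_entries_row i) i (by simp)
    (r := j * 2 + r) (by omega)
  rw [mem, encode, List.append_assoc, List.getD_append_right _ _ _ _ (by simp; omega),
    List.getD_append _ _ _ _ (by rw [length_entries]; simp; omega),
    show 3 + 2 * ((i : ℕ) * I.m + j) + r - [(I.n : ℤ), I.m, (I.row : ℕ)].length =
      i * (2 * I.m) + (j * 2 + r) by simp; ring_nf; omega, h2]
  simpa [Frac.encode] using h1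

theorem mem_start_add (j : Fin I.m) {r : ℕ} (hr : r < (I.dist j).encode.length) :
    I.mem (I.start j + r) = (I.dist j).encode.getD r 0 := by
  have h := List.getD_flatMap (fun j => (I.dist j).encode) 0 (List.finRange I.m) j (by simp)
    (r := r) (by simpa using hr)
  rw [mem, encode, List.append_assoc, List.getD_append_right _ _ _ _ (by simp [start]; omega),
    List.getD_append_right _ _ _ _ (by rw [length_entries]; simp [start]; omega),
    length_entries, start, add_assoc (3 + _), add_assoc 3]
  simp only [List.length_cons, List.length_nil, zero_add, Nat.reduceAdd, Nat.add_sub_cancel_left]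
  rw [h]
  simp

theorem mem_start (j : Fin I.m) : I.mem (I.start j) = (I.dist j).pairs.length := by
  simpa [FinDist.encode] using
    I.mem_start_add j (r := 0) (by rw [FinDist.length_encode]; omega)

theorem mem_field (j : Fin I.m) (c : Fin (I.dist j).pairs.length) {r : ℕ} (hr : r < 4) :
    I.mem (I.start j + (1 + r + 4 * c)) = [((I.dist j).pairs.get c).1.num,
      ((I.dist j).pairs.get c).1.den, ((I.dist j).pairs.get c).2.num,
      ((I.dist j).pairs.get c).2.den].getD r 0 := by
  have := c.2
  rw [mem_start_add _ _ (by rw [FinDist.length_encode]; omega), FinDist.getD_encode _ _ hr]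

theorem start_succ (j : Fin I.m) :
    I.start (j + 1) = I.start j + 1 + 4 * (I.dist j).pairs.length := by
  rw [start, start, List.take_succ_eq_append_getElem (by simp), List.map_append,
    List.sum_append]
  simp [FinDist.length_encode]
  ring

theorem start_mono {j j' : ℕ} (h : j ≤ j') : I.start j ≤ I.start j' := by
  refine Nat.add_le_add_left (List.Sublist.sum_le_sum ?_ (by simp)) _
  exact (List.take_sublist_take_left h).map _

theorem length_encode : I.encode.length = I.start I.m := by
  rw [encode, List.length_append, List.length_append, length_entries, start,
    List.take_of_length_le (by simp), List.length_flatMap]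
  rfl

theorem add_le_start (j : ℕ) (hj : j ≤ I.m) : 3 + 2 * (I.n * I.m) + j ≤ I.start j := by
  induction j with
  | zero => simp [start]
  | succ j ih =>
    have := I.start_succ ⟨j, hj⟩
    have := ih (by omega)
    simp at *
    omega

theorem numCols_le : I.m ≤ I.encode.length := by
  rw [length_encode]
  exact (Nat.le_add_left _ _).trans (I.add_le_start _ le_rfl)

/-- Without columns the matrix occupies no cells and the row count is just one integer, which may
exceed the length of the input; loops over rows would then be too short. -/
theorem numRows_le (h : 0 < I.m) : I.n ≤ I.encode.length := by
  have h1 := I.add_le_start _ le_rfl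
  have h2 := Nat.le_mul_of_pos_right I.n h
  rw [length_encode]
  omega

theorem numPairs_le (j : Fin I.m) : (I.dist j).pairs.length ≤ I.encode.length := by
  have h1 := I.start_mono (Nat.succ_le_iff.2 j.2)
  have h2 := I.start_succ j
  rw [length_encode]
  simp at h1
  omega

end Instance

end Ranking

/-! ### Derived expressions -/

namespace RAM.Term

variable {L : ℕ} {mem : ℕ → ℤ}

/-- Sum over the values of `v` below `b`. -/
def sumLt (v : ℕ) (b e : Term) : Term := sum v (ite (sub b (var v)) e (const 0))

/-- Product over the values of `v` below `b`. -/
def prodLt (v : ℕ) (b e : Term) : Term := prod v (ite (sub b (var v)) e (const 1))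

/-- The truth value of `c > 0`. -/
def test (c : Term) : Term := ite c (const 1) (const 0)

/-- The truth value of `a ≠ b`. -/
def neq (a b : Term) : Term := ite (sub a b) (const 1) (test (sub b a))

theorem eval_sumLt {v : ℕ} {b e : Term} {env : ℕ → ℤ} {N : ℕ} (hN : N ≤ L)
    (hb : ∀ i : ℕ, b.eval L mem (Function.update env v i) = N) :
    (sumLt v b e).eval L mem env =
      ∑ i : Fin N, e.eval L mem (Function.update env v ((i : ℕ) : ℤ)) := by
  rw [← Finset.sum_range fun i : ℕ => e.eval L mem (Function.update env v (i : ℤ))]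
  simp only [sumLt, eval, hb, Function.update_self, sub_pos, Nat.cast_lt]
  rw [← Finset.sum_filter]
  congr 1
  ext i
  simp
  omega

theorem eval_prodLt {v : ℕ} {b e : Term} {env : ℕ → ℤ} {N : ℕ} (hN : N ≤ L)
    (hb : ∀ i : ℕ, b.eval L mem (Function.update env v i) = N) :
    (prodLt v b e).eval L mem env =
      ∏ i : Fin N, e.eval L mem (Function.update env v ((i : ℕ) : ℤ)) := by
  rw [← Finset.prod_range fun i : ℕ => e.eval L mem (Function.update env v (i : ℤ))]
  simp only [prodLt, eval, hb, Function.update_self, sub_pos, Nat.cast_lt]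
  rw [← Finset.prod_filter]
  congr 1
  ext i
  simp
  omega

theorem eval_test {c : Term} {env : ℕ → ℤ} {p : Prop} [Decidable p]
    (h : 0 < c.eval L mem env ↔ p) : (test c).eval L mem env = if p then 1 else 0 :=
  if_congr h rfl rfl

theorem eval_neq (a b : Term) (env : ℕ → ℤ) :
    (neq a b).eval L mem env = if a.eval L mem env ≠ b.eval L mem env then 1 else 0 := by
  simp only [neq, test, eval]
  split_ifs <;> omega

end RAM.Term

namespace Ranking

open RAM RAM.Term

/-! ### Expressions for the data of an instance -/

/-- The number of rows. -/
def numRows : Term := .mem (.const 0)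

/-- The number of columns. -/
def numCols : Term := .mem (.const 1)

/-- The row of interest. -/
def rowTerm : Term := .mem (.const 2)

/-- The numerator (`r = 0`) or denominator (`r = 1`) of the entry in row `i` and column `j`. -/
def entryTerm (r : ℕ) (i j : Term) : Term :=
  .mem (add (add (const 3) (mul (const 2) (add (mul i numCols) j))) (const r))

/-- The address of the first distribution. -/
def baseTerm : Term := add (const 3) (mul (const 2) (mul numRows numCols))

/-- The address of the distribution of the column `var j`, for `j ≥ 2`. -/
def startTerm (j : ℕ) : Term :=
  add baseTerm <| iter 0 1 <| ite (sub (var j) (var 0))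
    (add (add (var 1) (const 1)) (mul (const 4) (.mem (add baseTerm (var 1))))) (var 1)

/-- The number of pairs of the distribution of the column `var j`. -/
def lengthTerm (j : ℕ) : Term := .mem (startTerm j)

/-- The `r`th of the four integers of the pair `var c` of the distribution of the column `var j`. -/
def fieldTerm (r j c : ℕ) : Term :=
  .mem (add (startTerm j) (add (const (1 + r)) (mul (const 4) (var c))))

/-- Positive, zero, negative according to whether `a / b` is less than, equal to, greater than
`c / d`. -/
def crossTerm (a b c d : Term) : Term := mul (sub (mul c b) (mul a d)) (mul b d)

section

variable {I : Instance} {env : ℕ → ℤ}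

@[simp] theorem eval_numRows : numRows.eval I.encode.length I.mem env = I.n := rfl

@[simp] theorem eval_numCols : numCols.eval I.encode.length I.mem env = I.m := rfl

@[simp] theorem eval_rowTerm : rowTerm.eval I.encode.length I.mem env = (I.row : ℕ) := rfl

theorem eval_entryTerm {a b : Term} {i : Fin I.n} {j : Fin I.m} {r : ℕ} (hr : r < 2)
    (ha : a.eval I.encode.length I.mem env = (i : ℕ))
    (hb : b.eval I.encode.length I.mem env = (j : ℕ)) :
    Term.eval I.encode.length I.mem (entryTerm r a b) env =
      [(I.entry i j).num, (I.entry i j).den].getD r 0 := by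
  rw [← I.mem_entry i j hr]
  simp only [entryTerm, eval, ha, hb, eval_numCols]
  congr 1

theorem eval_baseTerm : baseTerm.eval I.encode.length I.mem env = I.start 0 := by
  simp [baseTerm, eval, Instance.start]

/-- The iteration always makes `L` steps, but only those with index below `a`, the last `a` ones,
jump to the next distribution. With `t` steps left, `a - t` jumps are done; truncated subtraction
makes this `0` during the idle steps. Offsets never exceed the input length, so the cut-off is
inactive. -/
theorem descend_start {a : ℕ} (t : ℕ) (x : ℕ)
    (hx : I.start 0 + x = I.start (a - t)) (ha : a ≤ I.m) :
    (I.start 0 : ℤ) + descend (fun i (x : ℤ) => clamp I.encode.length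
      (if 0 < (a : ℤ) - i then x + 1 + 4 * I.mem (I.start 0 + x).toNat else x)) t x =
      I.start a := by
  induction t generalizing x with
  | zero => rw [descend]; exact_mod_cast hx
  | succ t ih =>
    rw [descend]
    by_cases h : t < a
    · have hs := I.start_succ ⟨a - (t + 1), by omega⟩
      have hm := I.mem_start ⟨a - (t + 1), by omega⟩
      have hle := I.start_mono (show a - t ≤ I.m by omega)
      rw [← I.length_encode] at hle
      simp only [← hx, show a - (t + 1) + 1 = a - t by omega] at hs hm
      set q := (I.dist ⟨a - (t + 1), by omega⟩).pairs.length
      have e : ((I.start 0 : ℤ) + x).toNat = I.start 0 + x := by omega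
      rw [if_pos (by omega), e, hm, clamp_of_le (by positivity) (by omega)]
      exact_mod_cast ih (x + 1 + 4 * q) (by omega)
    · have hle := I.start_mono (show a - t ≤ I.m by omega)
      rw [← I.length_encode] at hle
      rw [show a - (t + 1) = a - t by omega] at hx
      rw [if_neg (by omega), clamp_of_le (by positivity) (by omega)]
      exact ih x hx

theorem eval_startTerm {a : ℕ} (ha : 2 ≤ a) {j : Fin I.m} (hj : env a = (j : ℕ)) :
    Term.eval I.encode.length I.mem (startTerm a) env = I.start j := by
  have h := descend_start I.encode.length 0 (a := j)
    (by rw [Nat.sub_eq_zero_of_le (j.2.le.trans I.numCols_le)]; rfl) j.2.le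
  rw [← h]
  simp only [startTerm, eval, eval_baseTerm, Function.update_self,
    Function.update_of_ne (show a ≠ 0 by omega), Function.update_of_ne (show a ≠ 1 by omega),
    Function.update_of_ne (show (0 : ℕ) ≠ 1 by omega), hj]
  rfl

theorem eval_lengthTerm {a : ℕ} (ha : 2 ≤ a) {j : Fin I.m} (hj : env a = (j : ℕ)) :
    Term.eval I.encode.length I.mem (lengthTerm a) env = (I.dist j).pairs.length := by
  rw [lengthTerm, eval, eval_startTerm ha hj, Int.toNat_natCast, I.mem_start]

theorem eval_fieldTerm {a b : ℕ} (ha : 2 ≤ a) {j : Fin I.m} (hj : env a = (j : ℕ))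
    {c : Fin (I.dist j).pairs.length} (hc : env b = (c : ℕ)) {r : ℕ} (hr : r < 4) :
    Term.eval I.encode.length I.mem (fieldTerm r a b) env = [((I.dist j).pairs.get c).1.num,
      ((I.dist j).pairs.get c).1.den, ((I.dist j).pairs.get c).2.num,
      ((I.dist j).pairs.get c).2.den].getD r 0 := by
  rw [← I.mem_field j c hr]
  simp only [fieldTerm, eval, eval_startTerm ha hj, hc]
  congr 1

/-! ### Expressions for the original order -/

theorem sum_boole_pos_iff {ι : Type*} [Fintype ι] (p : ι → Prop) [DecidablePred p] :
    0 < ∑ i, (if p i then 1 else 0 : ℤ) ↔ ∃ i, p i := by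
  rw [Finset.sum_boole]
  simp [Finset.card_pos, Finset.filter_nonempty_iff]

/-- The entry in row `var 14` and column `var 12` exceeds the entry of the row of interest in
column `var 10`, or it is equal to it and row `var 14` has the smaller index. -/
def exceedsTerm : Term :=
  test <| add (crossTerm (entryTerm 0 rowTerm (var 10)) (entryTerm 1 rowTerm (var 10))
    (entryTerm 0 (var 14) (var 12)) (entryTerm 1 (var 14) (var 12))) (test (sub rowTerm (var 14)))

/-- Row `var 14` is originally ranked before the row of interest. -/
def beforeTerm : Term :=
  test <| sumLt 12 numCols <| prodLt 10 numCols exceedsTerm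

/-- The row of interest is at most at position `K` (counted from `0`) in the original order. -/
def initialTerm (K : ℕ) : Term := test <| sub (const (K + 1)) <| sumLt 14 numRows beforeTerm

theorem eval_exceedsTerm {i' : Fin I.n} {j' j : Fin I.m} (h14 : env 14 = (i' : ℕ))
    (h12 : env 12 = (j' : ℕ)) (h10 : env 10 = (j : ℕ)) :
    exceedsTerm.eval I.encode.length I.mem env = if I.matrix I.row j < I.matrix i' j' ∨
      I.matrix I.row j = I.matrix i' j' ∧ i' < I.row then 1 else 0 := by
  refine eval_test ?_
  have hflag : (test (sub rowTerm (var 14))).eval I.encode.length I.mem env =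
      if i' < I.row then 1 else 0 := eval_test (by simp [eval, h14])
  simp only [eval, crossTerm, hflag,
    eval_entryTerm (show 0 < 2 by omega) (eval_rowTerm (env := env)) (b := var 10) h10,
    eval_entryTerm (show 1 < 2 by omega) (eval_rowTerm (env := env)) (b := var 10) h10,
    eval_entryTerm (show 0 < 2 by omega) (a := var 14) h14 (b := var 12) h12,
    eval_entryTerm (show 1 < 2 by omega) (a := var 14) h14 (b := var 12) h12]
  exact cross_pos_iff (Frac.den_ne_zero _) (Frac.den_ne_zero _) _

theorem eval_beforeTerm [Nonempty (Fin I.m)] {i' : Fin I.n} (h14 : env 14 = (i' : ℕ)) :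
    beforeTerm.eval I.encode.length I.mem env =
      if i' ∈ before I.matrix I.row then 1 else 0 := by
  refine eval_test ?_
  rw [eval_sumLt I.numCols_le fun _ => rfl, mem_before_iff_forall, ← sum_boole_pos_iff]
  refine iff_of_eq (congrArg _ (Finset.sum_congr rfl fun j' _ => ?_))
  rw [eval_prodLt I.numCols_le fun _ => rfl, Finset.prod_congr rfl fun j _ =>
    eval_exceedsTerm (i' := i') (j' := j') (j := j) (by simpa) (by simp) (by simp)]
  convert Fintype.prod_boole

theorem eval_initialTerm (hm : 0 < I.m) (K : ℕ) :
    Term.eval I.encode.length I.mem (initialTerm K) env =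
      if (before I.matrix I.row).card ≤ K then 1 else 0 := by
  have : Nonempty (Fin I.m) := ⟨⟨0, hm⟩⟩
  refine eval_test ?_
  rw [eval, eval_sumLt (I.numRows_le hm) fun _ => rfl,
    Finset.sum_congr rfl fun i' _ => eval_beforeTerm (i' := i') (by simp),
    Finset.sum_boole, Finset.filter_univ_mem, eval]
  omega

end

end Ranking

/-! ### Expressions for the weighted matrix -/

namespace Ranking

open RAM RAM.Term

/-- The entry in row `var 14` and column `var 12`, weighted with the value `var 13` from the list
of that column, conforms to the entry of the row of interest in column `var 10`, weighted with
the value `var 11` from the list of that column. -/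
def conformsTerm : Term :=
  test <| add
    (crossTerm
      (mul (entryTerm 0 (var 14) (var 12)) (fieldTerm 0 12 13))
      (mul (entryTerm 1 (var 14) (var 12)) (fieldTerm 1 12 13))
      (mul (entryTerm 0 rowTerm (var 10)) (fieldTerm 0 10 11))
      (mul (entryTerm 1 rowTerm (var 10)) (fieldTerm 1 10 11)))
    (ite (sub (var 14) rowTerm) (const 1) (ite (sub rowTerm (var 14)) (const 0)
      (test (sub (add (var 12) (const 1)) (var 10)))))

/-- Row `var 14` is not among the rows `var t` for `t` in `T`. -/
def notMemTerm (T : List ℕ) : Term :=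
  T.foldr (fun t e => mul (neq (var t) (var 14)) e) (const 1)

/-- The choice `var 13` for the column `var 12` is compatible with the choice `var 11` for the
column `var 10`, and the entries of that column conform, except for rows in `T`. -/
def admissibleTerm (T : List ℕ) : Term :=
  mul (ite (neq (var 12) (var 10)) (const 1) (ite (neq (var 13) (var 11)) (const 0) (const 1)))
    (prodLt 14 numRows (ite (notMemTerm T) conformsTerm
      (ite (neq rowTerm (var 14)) (const 1) conformsTerm)))

/-- The integer weight of the choice `var 13` for the column `var 12`. -/
def weightTerm : Term :=
  mul (fieldTerm 2 12 13) (prodLt 15 (lengthTerm 12)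
    (ite (neq (var 15) (var 13)) (fieldTerm 3 12 15) (const 1)))

/-- The total weight of the admissible choices. -/
def admissibleWeightTerm (T : List ℕ) : Term :=
  prodLt 12 numCols (sumLt 13 (lengthTerm 12) (mul (admissibleTerm T) weightTerm))

/-- `l!` times the total weight of the choices with `var 11` in column `var 10` for which the row
of interest has its leftmost maximum in column `var 10`, and at most `l` rows outside of `T` are
ranked before it. -/
def fewBeforeTerm : ℕ → List ℕ → Term
  | 0, T => admissibleWeightTerm T
  | l + 1, T => add (mul (const (l + 1)) (fewBeforeTerm l T))
      (sumLt (20 + l) numRows (sub (fewBeforeTerm l ((20 + l) :: T)) (fewBeforeTerm l T)))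

/-- `K!` times the total weight of the choices for which the row of interest is at most at
position `K`. -/
def topWeightTerm (K : ℕ) : Term :=
  sumLt 10 numCols (sumLt 11 (lengthTerm 10) (fewBeforeTerm K []))

/-- The product of the denominators of all probabilities. -/
def denProdTerm : Term := prodLt 12 numCols (prodLt 15 (lengthTerm 12) (fieldTerm 3 12 15))

section

variable {I : Instance} {env : ℕ → ℤ}

theorem eval_conformsTerm {i' : Fin I.n} {j j' : Fin I.m} {c₀ : Fin (I.dist j).pairs.length}
    {c' : Fin (I.dist j').pairs.length} (h10 : env 10 = (j : ℕ)) (h11 : env 11 = (c₀ : ℕ))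
    (h12 : env 12 = (j' : ℕ)) (h13 : env 13 = (c' : ℕ)) (h14 : env 14 = (i' : ℕ)) :
    conformsTerm.eval I.encode.length I.mem env =
      if Conforms (I.matrix i' j' * (I.dist j').value c') (I.matrix I.row j * (I.dist j).value c₀)
        I.row j i' j' then 1 else 0 := by
  refine eval_test ?_
  have hflag : (ite (sub (var 14) rowTerm) (const 1) (ite (sub rowTerm (var 14)) (const 0)
      (test (sub (add (var 12) (const 1)) (var 10))))).eval I.encode.length I.mem env =
      if I.row < i' ∨ I.row = i' ∧ j ≤ j' then 1 else 0 := by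
    have h := eval_test (L := I.encode.length) (mem := I.mem) (env := env)
      (c := sub (add (var 12) (const 1)) (var 10)) (p := j ≤ j')
      (by simp only [eval, h12, h10, Fin.le_def]; omega)
    simp only [eval, h, eval_rowTerm, h14, sub_pos, Nat.cast_lt, Fin.val_fin_lt]
    rcases lt_trichotomy I.row i' with h | h | h
    · simp [h]
    · simp [h]
    · simp [h, h.not_gt, h.ne']
  have hrow := eval_rowTerm (I := I) (env := env)
  simp only [eval, crossTerm] at hflag ⊢
  rw [hflag, eval_entryTerm (show 0 < 2 by omega) hrow (b := var 10) h10,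
    eval_entryTerm (show 1 < 2 by omega) hrow (b := var 10) h10,
    eval_entryTerm (show 0 < 2 by omega) (a := var 14) h14 (b := var 12) h12,
    eval_entryTerm (show 1 < 2 by omega) (a := var 14) h14 (b := var 12) h12,
    eval_fieldTerm (by omega) h12 h13 (by omega), eval_fieldTerm (by omega) h12 h13 (by omega),
    eval_fieldTerm (by omega) h10 h11 (by omega), eval_fieldTerm (by omega) h10 h11 (by omega)]
  refine (cross_pos_iff (mul_ne_zero (Frac.den_ne_zero _) (Frac.den_ne_zero _))
    (mul_ne_zero (Frac.den_ne_zero _) (Frac.den_ne_zero _)) _).trans ?_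
  simp only [Int.cast_mul, mul_div_mul_comm]
  rfl

theorem eval_notMemTerm (T : List ℕ) {L : ℕ} {mem : ℕ → ℤ} :
    Term.eval L mem (notMemTerm T) env = if ∀ t ∈ T, env t ≠ env 14 then 1 else 0 := by
  induction T with
  | nil => simp [notMemTerm, eval]
  | cons t T ih =>
    rw [notMemTerm, List.foldr_cons, ← notMemTerm, eval, ih, eval_neq]
    simp only [eval, List.forall_mem_cons]
    by_cases h : env t = env 14 <;> simp [h]

variable (I) in
/-- The matrix with the weights given by a choice. -/
def Instance.drawn (c : I.Choice) : Matrix (Fin I.n) (Fin I.m) ℚ :=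
  weighted I.matrix fun j => (I.dist j).value (c j)

variable (I env) in
/-- The rows `env t` for `t` in `T`. -/
def excused (T : List ℕ) : Finset (Fin I.n) :=
  Finset.univ.filter fun i' => ∃ t ∈ T, env t = (i' : ℕ)

variable (I) in
/-- The choice `c'` for the column `j'` is compatible with the choice `c₀` for the column `j`,
and the entries of that column conform, except for rows in `S`. -/
def Admissible (S : Finset (Fin I.n)) (j : Fin I.m) (c₀ : Fin (I.dist j).pairs.length)
    (j' : Fin I.m) (c' : Fin (I.dist j').pairs.length) : Prop :=
  (j' = j → (c' : ℕ) = c₀) ∧ ∀ i', (i' ∈ S ∧ i' ≠ I.row) ∨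
    Conforms (I.matrix i' j' * (I.dist j').value c') (I.matrix I.row j * (I.dist j).value c₀)
      I.row j i' j'

/-- The condition at column `j` forces `c j = c₀`, so all columns are compared with the same
threshold; the rest is an exchange of the quantifiers over rows and columns. The row of interest is
never excused, even if it belongs to `S`. -/
theorem forall_admissible_iff {S : Finset (Fin I.n)} {j : Fin I.m}
    {c₀ : Fin (I.dist j).pairs.length} {c : I.Choice} :
    (∀ j', Admissible I S j c₀ j' (c j')) ↔ c j = c₀ ∧ I.row ∉ violating (I.drawn c) I.row j ∧
      violating (I.drawn c) I.row j ⊆ S := by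
  have key : ∀ i', i' ∉ violating (I.drawn c) I.row j ↔ ∀ j', Conforms
      (I.matrix i' j' * (I.dist j').value (c j')) (I.matrix I.row j * (I.dist j).value (c j))
      I.row j i' j' := by
    intro i'
    rw [mem_violating]
    push Not
    rfl
  constructor
  · intro h
    have hc : c j = c₀ := Fin.ext ((h j).1 rfl)
    subst hc
    refine ⟨rfl, (key _).2 fun j' => ?_, fun i' hi' => ?_⟩
    · exact ((h j').2 I.row).resolve_left fun h => h.2 rfl
    · by_contra hS
      exact (key i').2 (fun j' => ((h j').2 i').resolve_left fun h => hS h.1) hi'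
  · rintro ⟨rfl, h1, h2⟩ j'
    refine ⟨fun h => by subst h; rfl, fun i' => ?_⟩
    by_cases hi : i' ∈ violating (I.drawn c) I.row j
    · exact .inl ⟨h2 hi, fun h => h1 (h ▸ hi)⟩
    · exact .inr ((key i').1 hi j')

theorem eval_admissibleTerm {T : List ℕ} (hT : ∀ t ∈ T, 20 ≤ t) {j j' : Fin I.m}
    {c₀ : Fin (I.dist j).pairs.length} {c' : Fin (I.dist j').pairs.length}
    (h10 : env 10 = (j : ℕ)) (h11 : env 11 = (c₀ : ℕ)) (h12 : env 12 = (j' : ℕ))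
    (h13 : env 13 = (c' : ℕ)) [Decidable (Admissible I (excused I env T) j c₀ j' c')] :
    Term.eval I.encode.length I.mem (admissibleTerm T) env =
      if Admissible I (excused I env T) j c₀ j' c' then 1 else 0 := by
  have hn := I.numRows_le j.pos
  have hrow : ∀ i' : Fin I.n, (ite (notMemTerm T) conformsTerm
      (ite (neq rowTerm (var 14)) (const 1) conformsTerm)).eval I.encode.length I.mem
      (Function.update env 14 ((i' : ℕ) : ℤ)) =
      if (i' ∈ excused I env T ∧ i' ≠ I.row) ∨ Conforms (I.matrix i' j' * (I.dist j').value c')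
        (I.matrix I.row j * (I.dist j).value c₀) I.row j i' j' then 1 else 0 := by
    intro i'
    have h := eval_conformsTerm (env := Function.update env 14 ((i' : ℕ) : ℤ)) (i' := i')
      (j := j) (j' := j') (c₀ := c₀) (c' := c') (by simpa) (by simpa) (by simpa) (by simpa)
      (by simp)
    have hmem : (∀ t ∈ T, Function.update env 14 ((i' : ℕ) : ℤ) t ≠
        Function.update env 14 ((i' : ℕ) : ℤ) 14) ↔ i' ∉ excused I env T := by
      simp only [excused, Finset.mem_filter, Finset.mem_univ, true_and, not_exists, not_and,
        Function.update_self]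
      refine forall₂_congr fun t ht => ?_
      have := hT t ht
      rw [Function.update_of_ne (by omega)]
    have h1 : (notMemTerm T).eval I.encode.length I.mem
        (Function.update env 14 ((i' : ℕ) : ℤ)) = if i' ∉ excused I env T then 1 else 0 :=
      (eval_notMemTerm T).trans (if_congr hmem rfl rfl)
    have h2 : (neq rowTerm (var 14)).eval I.encode.length I.mem
        (Function.update env 14 ((i' : ℕ) : ℤ)) = if i' ≠ I.row then 1 else 0 :=
      (eval_neq ..).trans (if_congr (by simp [eval, Fin.ext_iff, eq_comm]) rfl rfl)
    simp only [eval, h, h1, h2]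
    by_cases h3 : i' ∈ excused I env T <;> by_cases h4 : i' = I.row <;> simp [h3, h4]
  have hcol : (ite (neq (var 12) (var 10)) (const 1)
      (ite (neq (var 13) (var 11)) (const 0) (const 1))).eval I.encode.length I.mem env =
      if j' = j → (c' : ℕ) = c₀ then 1 else 0 := by
    simp only [eval, eval_neq, h10, h11, h12, h13]
    by_cases h1 : j' = j
    · by_cases h2 : (c' : ℕ) = c₀ <;> simp [h1, h2]
    · have h3 : ¬ (j' : ℕ) = j := fun h => h1 (Fin.ext h)
      simp [h1, h3]
  have hrows : (prodLt 14 numRows (ite (notMemTerm T) conformsTerm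
      (ite (neq rowTerm (var 14)) (const 1) conformsTerm))).eval I.encode.length I.mem env =
      if ∀ i', (i' ∈ excused I env T ∧ i' ≠ I.row) ∨ Conforms
        (I.matrix i' j' * (I.dist j').value c') (I.matrix I.row j * (I.dist j).value c₀)
        I.row j i' j' then 1 else 0 := by
    rw [eval_prodLt hn fun _ => rfl, Finset.prod_congr rfl fun i' _ => hrow i']
    convert Fintype.prod_boole
  rw [admissibleTerm, eval, hcol, hrows, ite_zero_mul_ite_zero, mul_one]
  exact if_congr Iff.rfl rfl rfl

theorem eval_weightTerm {j : Fin I.m} {c : Fin (I.dist j).pairs.length}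
    (h12 : env 12 = (j : ℕ)) (h13 : env 13 = (c : ℕ)) :
    weightTerm.eval I.encode.length I.mem env = I.weight j c := by
  rw [weightTerm, eval, eval_fieldTerm (by omega) h12 h13 (by omega),
    eval_prodLt (I.numPairs_le j) fun _ => eval_lengthTerm (by omega) (by simpa), Instance.weight]
  congr 1
  refine Finset.prod_congr rfl fun c' _ => ?_
  have h := eval_fieldTerm (I := I) (env := Function.update env 15 ((c' : ℕ) : ℤ)) (a := 12)
    (b := 15) (by omega) (j := j) (by simpa) (c := c') (by simp) (r := 3) (by omega)
  simp only [eval, eval_neq, h]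
  simp [h13, Fin.ext_iff]
  split_ifs <;> simp_all

theorem eval_denProdTerm : denProdTerm.eval I.encode.length I.mem env = I.denProd := by
  rw [denProdTerm, eval_prodLt I.numCols_le fun _ => rfl, Instance.denProd]
  refine Finset.prod_congr rfl fun j _ => ?_
  rw [eval_prodLt (I.numPairs_le j) fun _ => eval_lengthTerm (by omega) (by simp)]
  refine Finset.prod_congr rfl fun c _ => ?_
  rw [eval_fieldTerm (by omega) (j := j) (by simp) (c := c) (by simp) (by omega)]
  rfl

theorem excused_update {T : List ℕ} {v : ℕ} (hv : ∀ t ∈ T, t ≠ v) (z : ℤ) :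
    excused I (Function.update env v z) T = excused I env T := by
  refine Finset.filter_congr fun i' _ => exists_congr fun t => and_congr_right fun ht => ?_
  rw [Function.update_of_ne (hv t ht)]

theorem excused_cons {T : List ℕ} {v : ℕ} (hv : ∀ t ∈ T, t ≠ v) (b : Fin I.n) :
    excused I (Function.update env v ((b : ℕ) : ℤ)) (v :: T) = insert b (excused I env T) := by
  rw [← excused_update hv ((b : ℕ) : ℤ)]
  ext i'
  simp [excused, Fin.ext_iff, eq_comm]

theorem eval_admissibleWeightTerm {T : List ℕ} (hT : ∀ t ∈ T, 20 ≤ t) {j : Fin I.m}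
    {c₀ : Fin (I.dist j).pairs.length} (h10 : env 10 = (j : ℕ)) (h11 : env 11 = (c₀ : ℕ)) :
    Term.eval I.encode.length I.mem (admissibleWeightTerm T) env =
      ∑ c : I.Choice, (∏ j', I.weight j' (c j')) *
        if c j = c₀ ∧ I.row ∉ violating (I.drawn c) I.row j ∧
          violating (I.drawn c) I.row j ⊆ excused I env T then 1 else 0 := by
  classical
  simp only [← forall_admissible_iff]
  rw [← prod_sum_ite I.weight fun j' => Admissible I (excused I env T) j c₀ j',
    admissibleWeightTerm, eval_prodLt I.numCols_le fun _ => rfl]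
  refine Finset.prod_congr rfl fun j' _ => ?_
  rw [eval_sumLt (I.numPairs_le j') fun _ => eval_lengthTerm (by omega) (by simp)]
  refine Finset.sum_congr rfl fun c' _ => ?_
  rw [eval, eval_weightTerm (j := j') (c := c') (by simp) (by simp),
    eval_admissibleTerm hT (j := j) (j' := j') (c₀ := c₀) (c' := c') (by simpa) (by simpa)
      (by simp) (by simp)]
  have he : excused I (Function.update (Function.update env 12 ((j' : ℕ) : ℤ)) 13
      ((c' : ℕ) : ℤ)) T = excused I env T := by
    rw [excused_update fun t ht => by have := hT t ht; omega,
      excused_update fun t ht => by have := hT t ht; omega]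
  rw [he]

/-- The cardinality recursion is applied for each choice to the violating rows outside of the
excused ones, then summed. Level `l` binds only row variables below `20 + l`, so the hypothesis on
`T` prevents it from overwriting the excused rows. -/
theorem eval_fewBeforeTerm (l : ℕ) {T : List ℕ} (hT : ∀ t ∈ T, 20 + l ≤ t) {env : ℕ → ℤ}
    {j : Fin I.m} {c₀ : Fin (I.dist j).pairs.length} (h10 : env 10 = (j : ℕ))
    (h11 : env 11 = (c₀ : ℕ)) :
    Term.eval I.encode.length I.mem (fewBeforeTerm l T) env =
      ∑ c : I.Choice, (∏ j', I.weight j' (c j')) *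
        if c j = c₀ ∧ I.row ∉ violating (I.drawn c) I.row j then
          (l.factorial * if (violating (I.drawn c) I.row j \ excused I env T).card ≤ l
            then 1 else 0 : ℤ) else 0 := by
  induction l generalizing T env with
  | zero =>
    rw [fewBeforeTerm, eval_admissibleWeightTerm hT h10 h11]
    refine Finset.sum_congr rfl fun c _ => congrArg _ ?_
    simp only [← and_assoc, ite_and, Nat.le_zero, Finset.card_eq_zero,
      Finset.sdiff_eq_empty_iff_subset,
      Nat.factorial_zero, Nat.cast_one, one_mul]
  | succ l ih =>
    have hv : ∀ t ∈ T, t ≠ 20 + l := fun t ht => by have := hT t ht; omega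
    rw [fewBeforeTerm, eval, eval, eval, ih (fun t ht => by have := hT t ht; omega) h10 h11,
      eval_sumLt (I.numRows_le j.pos) fun _ => rfl]
    simp only [eval]
    have hb : ∀ b : Fin I.n, (Function.update env (20 + l) ((b : ℕ) : ℤ)) 10 = (j : ℕ) ∧
        (Function.update env (20 + l) ((b : ℕ) : ℤ)) 11 = (c₀ : ℕ) := fun b => by
      rw [Function.update_of_ne (by omega), Function.update_of_ne (by omega)]
      exact ⟨h10, h11⟩
    have hcons : ∀ t ∈ (20 + l) :: T, 20 + l ≤ t :=
      List.forall_mem_cons.2 ⟨le_rfl, fun t ht => by have := hT t ht; omega⟩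
    rw [Finset.sum_congr (s₁ := (Finset.univ : Finset (Fin I.n))) rfl fun b _ => congrArg₂ _
      (ih hcons (hb b).1 (hb b).2) (ih (List.forall_mem_cons.1 hcons).2 (hb b).1 (hb b).2)]
    simp only [excused_cons hv, excused_update hv, ← Finset.sum_sub_distrib]
    rw [Finset.sum_comm, Finset.mul_sum, ← Finset.sum_add_distrib]
    refine Finset.sum_congr rfl fun c _ => ?_
    simp only [← mul_sub]
    rw [← Finset.mul_sum, mul_left_comm, ← mul_add]
    congr 1
    by_cases h : c j = c₀ ∧ I.row ∉ violating (I.drawn c) I.row j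
    -- Excusing one more row `b` erases `b` from the set of violating rows not yet excused, which is
    -- the shape of the recursion.
    · simp only [if_pos h, card_le_succ_recursion, Finset.sdiff_insert]
    · simp [h]

/-- Each choice `c` is counted once in the double sum: `c₀` must equal `c j`, and only the column of
the leftmost maximum contributes. -/
theorem eval_topWeightTerm (hm : 0 < I.m) (K : ℕ) :
    Term.eval I.encode.length I.mem (topWeightTerm K) env =
      K.factorial * ∑ c : I.Choice, (∏ j', I.weight j' (c j')) *
        if (before (I.drawn c) I.row).card ≤ K then 1 else 0 := by
  have : Nonempty (Fin I.m) := ⟨⟨0, hm⟩⟩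
  have h : ∀ (j : Fin I.m) (env : ℕ → ℤ), env 10 = (j : ℕ) →
      Term.eval I.encode.length I.mem (sumLt 11 (lengthTerm 10) (fewBeforeTerm K [])) env =
      ∑ c : I.Choice, (∏ j', I.weight j' (c j')) *
        if I.row ∉ violating (I.drawn c) I.row j then
          (K.factorial * if (violating (I.drawn c) I.row j).card ≤ K
            then 1 else 0 : ℤ) else 0 := by
    intro j env hj
    rw [eval_sumLt (I.numPairs_le j) fun _ => eval_lengthTerm (by omega) (by simpa),
      Finset.sum_congr rfl fun c₀ _ => eval_fewBeforeTerm (c₀ := c₀) (j := j) K (by simp)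
        (by simpa) (by simp), Finset.sum_comm]
    refine Finset.sum_congr rfl fun c _ => ?_
    rw [← Finset.mul_sum]
    simp only [ite_and, Finset.sum_ite_eq, Finset.mem_univ, if_true]
    simp [excused]
  rw [topWeightTerm, eval_sumLt I.numCols_le fun _ => rfl,
    Finset.sum_congr rfl fun j _ => h j _ (by simp), Finset.sum_comm, Finset.mul_sum]
  refine Finset.sum_congr rfl fun c _ => ?_
  rw [← Finset.mul_sum, mul_left_comm, ← sum_violating, Finset.mul_sum _ _ (K.factorial : ℤ)]
  simp only [mul_ite, mul_one, mul_zero]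

end

/-! ### The expected effect as a fraction of expressions -/

/-- The numerator of the expected effect. -/
def effectNum (K : ℕ) : Term :=
  ite numCols (sub (topWeightTerm K) (mul (initialTerm K) (mul (const K.factorial) denProdTerm)))
    (const 0)

/-- The denominator of the expected effect. -/
def effectDen (K : ℕ) : Term := mul (const K.factorial) denProdTerm

theorem expectedEffect_eq (K : ℕ) (I : Instance) :
    expectedEffect maxDsc (topMembership (K + 1)) I =
      (∑ c : I.Choice, (∏ j, (I.dist j).prob (c j)) *
        if (before (I.drawn c) I.row).card ≤ K then 1 else 0) -
        if (before I.matrix I.row).card ≤ K then 1 else 0 := by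
  have h : ∀ a : ℚ, a = ∑ c : I.Choice, (∏ j, (I.dist j).prob (c j)) * a := fun a => by
    rw [← Finset.sum_mul, I.sum_prob, one_mul]
  rw [h (if (before I.matrix I.row).card ≤ K then 1 else 0), ← Finset.sum_sub_distrib,
    expectedEffect]
  refine Finset.sum_congr rfl fun c _ => ?_
  rw [← mul_sub]
  simp only [topMembership, maxDsc_apply, Nat.add_le_add_iff_right, Instance.drawn]
  push_cast
  rfl

theorem weighted_of_isEmpty {n m : ℕ} [IsEmpty (Fin m)] (M : Matrix (Fin n) (Fin m) ℚ)
    (u : Fin m → ℚ) : weighted M u = M := by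
  ext i j
  exact isEmptyElim j

theorem effect_spec (K : ℕ) (I : Instance) (env : ℕ → ℤ) :
    Term.eval I.encode.length I.mem (effectDen K) env ≠ 0 ∧
    (Term.eval I.encode.length I.mem (effectNum K) env : ℚ) /
      Term.eval I.encode.length I.mem (effectDen K) env =
      expectedEffect maxDsc (topMembership (K + 1)) I := by
  have hden : Term.eval I.encode.length I.mem (effectDen K) env = K.factorial * I.denProd := by
    rw [effectDen, eval, eval_denProdTerm, eval]
  have hne : (K.factorial * I.denProd : ℤ) ≠ 0 :=
    mul_ne_zero (by exact_mod_cast K.factorial_ne_zero) I.denProd_ne_zero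
  rw [hden]
  refine ⟨hne, ?_⟩
  rw [expectedEffect_eq]
  have hne' : (K.factorial : ℚ) * I.denProd ≠ 0 := by exact_mod_cast hne
  rcases Nat.eq_zero_or_pos I.m with hm | hm
  -- Without columns weighting changes nothing and the effect is `0`. This case needs its own branch
  -- in `effectNum`, since the sum over the column of the maximum is empty here.
  · have : IsEmpty (Fin I.m) := by rw [hm]; infer_instance
    simp only [Instance.drawn, weighted_of_isEmpty]
    rw [← Finset.sum_mul, I.sum_prob, one_mul, sub_self]
    simp [effectNum, eval, hm]
  · have hnum : Term.eval I.encode.length I.mem (effectNum K) env =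
        Term.eval I.encode.length I.mem (topWeightTerm K) env -
          Term.eval I.encode.length I.mem (initialTerm K) env * (K.factorial * I.denProd) := by
      simp [effectNum, eval, hm, eval_denProdTerm]
    rw [hnum, eval_topWeightTerm hm, eval_initialTerm hm]
    push_cast
    rw [div_eq_iff hne', sub_mul]
    congr 1
    rw [Finset.mul_sum, Finset.sum_mul]
    refine Finset.sum_congr rfl fun c _ => ?_
    have := I.prod_weight c
    push_cast at this
    rw [this]
    ring

end Ranking

theorem mainTheorem7 (k : ℕ) :
    Ranking.ExpSolvableInPolyTime Ranking.maxDsc (Ranking.topMembership k) := by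
  cases k with
  | zero =>
    -- For `k = 0` no row is ever in the top, so the answer is constantly `0 / 1`.
    refine RAM.solvableInPolyTime_of_terms (.const 0) (.const 1) fun I => ?_
    exact ⟨⟨0, 1, one_ne_zero⟩, rfl, by
      simp [Ranking.Frac.toRat, Ranking.expectedEffect, Ranking.topMembership]⟩
  | succ K =>
    refine RAM.solvableInPolyTime_of_terms (Ranking.effectNum K) (Ranking.effectDen K)
      fun I => ?_
    obtain ⟨hne, h⟩ := Ranking.effect_spec K I 0
    exact ⟨⟨_, _, hne⟩, rfl, h⟩
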